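/- Let $G$ be a (finite-dimensional, second countable) Lie group with Lie algebra $\mathfrak g$, regarded as a subgroup of $GL(k,\mathbb R)$ through an injective smooth representation $\rho:G\to GL(k,\mathbb R)$, with differential $d\rho:\mathfrak g\to\mathfrak{gl}(k,\mathbb R)$ at the identity. Let $E\to M$ be a $G$-vector bundle of rank $k$ over a smooth manifold $M$, i.e. a smooth vector bundle with a family of smooth local trivializations $\psi:E|_\theta\to\theta\times\mathbb R^k$, linear on fibres, whose domains cover $M$ and whose transition maps take values in $\rho(G)$. A basis of $E_x$ is called admissible if it is the image of the canonical basis of $\mathbb R^k$ under $\psi_x^{-1}\circ\rho(g)$ for one of these trivializations $\psi$ around $x$ and some $g\in G$. An admissible frame over an open set $U\subset M$ is a smooth frame $s=(s_1,\dots,s_k)$ of $E|_U$ such that $(s_1(x),\dots,s_k(x))$ is an admissible basis of $E_x$ for every $x\in U$. Let $\nabla$ be a smooth connection on $E$. It is called admissible if for every smooth curve $\sigma:[0,1]\to M$ the parallel transport $P_\sigma:E_{\sigma(0)}\to E_{\sigma(1)}$ takes admissible bases to admissible bases. In a frame $s$, the connection form $\omega$ and the curvature form $\Omega$ are the matrices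 given by $\nabla_v s_i=\sum_j\omega^j_i(v)\,s_j$ and $\big([\nabla_X,\nabla_Y]-\nabla_{[X,Y]}\big)s_i=\sum_j\Omega^j_i(X,Y)\,s_j$. \textbf{Theorem.} (1) $\nabla$ is admissible if and only if for every admissible frame $s$ over an open set $U\subset M$, every $x\in U$ and every $v\in T_xM$, the connection form $\omega$ in the frame $s$ satisfies $\omega(v)\in d\rho(\mathfrak g)$, i.e. $\omega(v)=d\rho(h)$ for some $h\in\mathfrak g$. (2) If $\nabla$ is admissible, then its curvature takes values in $\mathfrak g$: for every admissible frame $s$ over an open set $U$, all smooth vector fields $X,Y$ on $U$ and every $x\in U$, the curvature form $\Omega$ in the frame $s$ satisfies $\Omega(X,Y)_x\in d\rho(\mathfrak g)$. -/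

import Mathlib

open Bundle Set
open scoped Manifold ContDiff Matrix

noncomputable section

section LieGroupPart

variable {EG : Type*} [NormedAddCommGroup EG] [NormedSpace ℝ EG]
  {G : Type*} [TopologicalSpace G] [ChartedSpace EG G] [Group G] {k : ℕ}

/-- The representation `ρ : G → GL(k, ℝ)` is smooth: its matrix entries are smooth functions. -/
def IsSmoothRep (ρ : G →* GL (Fin k) ℝ) : Prop :=
  ∀ i j, ContMDiff 𝓘(ℝ, EG) 𝓘(ℝ, ℝ) ∞ (fun g : G => (ρ g : Matrix (Fin k) (Fin k) ℝ) i j)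

/-- The differential at the identity `dρ : 𝔤 → 𝔤𝔩(k, ℝ)` of a representation `ρ : G → GL(k, ℝ)`,
computed entrywise. -/
def diffRep (ρ : G →* GL (Fin k) ℝ) :
    GroupLieAlgebra 𝓘(ℝ, EG) G →ₗ[ℝ] Matrix (Fin k) (Fin k) ℝ where
  toFun h := Matrix.of fun i j =>
    mvfderiv 𝓘(ℝ, EG) (fun g : G => (ρ g : Matrix (Fin k) (Fin k) ℝ) i j) 1 h
  map_add' a b := by ext i j; simp
  map_smul' c a := by ext i j; simp

end LieGroupPart

section BundlePart

variable {E : Type*} [NormedAddCommGroup E] [NormedSpace ℝ E]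
  {M : Type*} [TopologicalSpace M] [ChartedSpace E M] {k : ℕ}
  {V : M → Type*} [TopologicalSpace (TotalSpace (Fin k → ℝ) V)]
  [∀ x, AddCommGroup (V x)] [∀ x, Module ℝ (V x)] [∀ x, TopologicalSpace (V x)]
  [FiberBundle (Fin k → ℝ) V]
  {G : Type*} [Group G]

variable (E V) in
/-- The structure of a `G`-vector bundle on the smooth rank `k` vector bundle `V → M`, where `G`
is a subgroup of `GL(k, ℝ)` through `ρ`: a family of smooth local trivializations (gauges), linear
on the fibres, whose domains cover `M` and whose transition maps take values in `G`. -/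
structure GBundleStructure (ρ : G →* GL (Fin k) ℝ) where
  /-- the local trivializations of the `G`-vector bundle -/
  gauges : Set (Trivialization (Fin k → ℝ) (π (Fin k → ℝ) V))
  linear : ∀ e ∈ gauges, e.IsLinear ℝ
  smooth : ∀ e ∈ gauges,
    ContMDiffOn (𝓘(ℝ, E).prod 𝓘(ℝ, Fin k → ℝ)) (𝓘(ℝ, E).prod 𝓘(ℝ, Fin k → ℝ)) ∞ e e.source
  smooth_symm : ∀ e ∈ gauges,
    ContMDiffOn (𝓘(ℝ, E).prod 𝓘(ℝ, Fin k → ℝ)) (𝓘(ℝ, E).prod 𝓘(ℝ, Fin k → ℝ)) ∞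
      e.toOpenPartialHomeomorph.symm e.target
  cover : ∀ x : M, ∃ e ∈ gauges, x ∈ e.baseSet
  transition : ∀ e ∈ gauges, ∀ e' ∈ gauges, ∀ x ∈ e.baseSet ∩ e'.baseSet,
    ∃ g : G, ∀ v : Fin k → ℝ,
      (e' ⟨x, e.symm x v⟩).2 = (ρ g : Matrix (Fin k) (Fin k) ℝ) *ᵥ v

/-- The admissible bases of the fibre `V x`: the images of the canonical basis of `ℝᵏ` under the
isomorphisms `e_x⁻¹ ∘ ρ(g) : ℝᵏ → V x`, with `e` a gauge around `x` and `g ∈ G`. -/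
def GBundleStructure.IsAdmissibleBasis {ρ : G →* GL (Fin k) ℝ} (𝒜 : GBundleStructure E V ρ)
    (x : M) (b : Fin k → V x) : Prop :=
  ∃ e ∈ 𝒜.gauges, x ∈ e.baseSet ∧ ∃ g : G, ∀ j,
    b j = e.symm x ((ρ g : Matrix (Fin k) (Fin k) ℝ) *ᵥ Pi.single j 1)

/-- A map `T : V x → V y` between fibres is a `G`-map if it takes admissible bases to admissible
bases. -/
def GBundleStructure.IsGMap {ρ : G →* GL (Fin k) ℝ} (𝒜 : GBundleStructure E V ρ)
    {x y : M} (T : V x → V y) : Prop :=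
  ∀ b : Fin k → V x, 𝒜.IsAdmissibleBasis x b → 𝒜.IsAdmissibleBasis y (fun j => T (b j))

/-- `s = (s₁, …, s_k)` is a smooth admissible frame over the open set `U`. -/
structure GBundleStructure.IsAdmissibleFrameOn {ρ : G →* GL (Fin k) ℝ}
    (𝒜 : GBundleStructure E V ρ) (s : Fin k → (x : M) → V x) (U : Set M) : Prop where
  isOpen : IsOpen U
  isLocalFrameOn : IsLocalFrameOn 𝓘(ℝ, E) (Fin k → ℝ) ∞ s U
  isAdmissibleBasis : ∀ x ∈ U, 𝒜.IsAdmissibleBasis x (fun j => s j x)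

variable [∀ x, IsTopologicalAddGroup (V x)] [∀ x, ContinuousSMul ℝ (V x)]

/-- The connection form of `∇` in the local frame `s`: the matrix `ω(v)`, `v ∈ T_xM`, with
`∇_v s_i = ∑ j, ω(v)^j_i s_j(x)` (row index `j`, column index `i`). -/
def connectionForm (cov : CovariantDerivative 𝓘(ℝ, E) (Fin k → ℝ) V)
    {s : Fin k → (x : M) → V x} {U : Set M}
    (hs : IsLocalFrameOn 𝓘(ℝ, E) (Fin k → ℝ) ∞ s U)
    (x : M) (v : TangentSpace 𝓘(ℝ, E) x) : Matrix (Fin k) (Fin k) ℝ :=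
  Matrix.of fun j i => hs.coeff j x (cov (s i) x v)

/-- The curvature `Ω(X, Y) s = ∇_X ∇_Y s - ∇_Y ∇_X s - ∇_[X,Y] s`. -/
def curvatureOperator (cov : CovariantDerivative 𝓘(ℝ, E) (Fin k → ℝ) V)
    (X Y : (x : M) → TangentSpace 𝓘(ℝ, E) x) (s : (x : M) → V x) (x : M) : V x :=
  cov (fun y => cov s y (Y y)) x (X x) - cov (fun y => cov s y (X y)) x (Y x)
    - cov s x (VectorField.mlieBracket 𝓘(ℝ, E) X Y x)

/-- The curvature form in the local frame `s`: the matrix `Ω(X, Y)_x` with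
`Ω(X, Y) s_i = ∑ j, Ω(X, Y)^j_i s_j` at `x`. -/
def curvatureForm (cov : CovariantDerivative 𝓘(ℝ, E) (Fin k → ℝ) V)
    {s : Fin k → (x : M) → V x} {U : Set M}
    (hs : IsLocalFrameOn 𝓘(ℝ, E) (Fin k → ℝ) ∞ s U)
    (X Y : (x : M) → TangentSpace 𝓘(ℝ, E) x) (x : M) : Matrix (Fin k) (Fin k) ℝ :=
  Matrix.of fun j i => hs.coeff j x (curvatureOperator cov X Y (s i) x)

/-- The velocity `σ'(t)` of a curve `σ : [0, 1] → M` (one-sided at the end points). -/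
def velocity (σ : ℝ → M) (t : ℝ) : TangentSpace 𝓘(ℝ, E) (σ t) :=
  mfderivWithin 𝓘(ℝ, ℝ) 𝓘(ℝ, E) σ (Icc 0 1) t (1 : ℝ)

/-- The section `ξ` of `V` along the curve `σ : [0, 1] → M` is parallel, `Dξ/dt = 0`: its
coefficients in each smooth local frame satisfy
`dξ^j/dt + ∑ i, ω(σ'(t))^j_i ξ^i = 0`. -/
def IsParallelAlong (cov : CovariantDerivative 𝓘(ℝ, E) (Fin k → ℝ) V)
    (σ : ℝ → M) (ξ : (t : ℝ) → V (σ t)) : Prop :=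
  ∀ (U : Set M) (s : Fin k → (x : M) → V x)
    (hs : IsLocalFrameOn 𝓘(ℝ, E) (Fin k → ℝ) ∞ s U), IsOpen U →
    ∀ t ∈ Icc (0 : ℝ) 1, σ t ∈ U → ∀ j,
      HasDerivWithinAt (fun τ => hs.coeff j (σ τ) (ξ τ))
        (-∑ i, connectionForm cov hs (σ t) (velocity σ t) j i * hs.coeff i (σ t) (ξ t))
        (Icc 0 1) t

open Classical in
/-- Parallel transport `P_σ : V (σ 0) → V (σ 1)` along `σ : [0, 1] → M`: the vector `v` is sent to
`ξ 1`, where `ξ` is the parallel section along `σ` with `ξ 0 = v`. (For a smooth curve and a smooth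
connection there is exactly one; the value `0` is never used.) -/
def parallelTransport (cov : CovariantDerivative 𝓘(ℝ, E) (Fin k → ℝ) V)
    (σ : ℝ → M) (v : V (σ 0)) : V (σ 1) :=
  if h : ∃ ξ : (t : ℝ) → V (σ t), IsParallelAlong cov σ ξ ∧ ξ 0 = v then h.choose 1 else 0

/-- The connection is admissible: parallel transport along each smooth curve `σ : [0, 1] → M` is
a `G`-map. -/
def GBundleStructure.IsAdmissibleConnection {ρ : G →* GL (Fin k) ℝ}
    (𝒜 : GBundleStructure E V ρ) (cov : CovariantDerivative 𝓘(ℝ, E) (Fin k → ℝ) V) : Prop :=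
  ∀ σ : ℝ → M, ContMDiffOn 𝓘(ℝ, ℝ) 𝓘(ℝ, E) ∞ σ (Icc 0 1) →
    𝒜.IsGMap (parallelTransport cov σ)

end BundlePart

end

open scoped Topology

/-! In an admissible frame, the coefficient matrix `A` of `k` parallel sections along `σ` solves `A'
= -ω(σ') A`, and these sections form an admissible basis at time `t` exactly when `A(t) ∈ ρ(G)`.
Part (1) therefore compares linear equations with coefficients in `dρ(𝔤)` with curves in `ρ(G)`.

If `ω` takes values in `dρ(𝔤)`, write `-ω(σ') = dρ(β)` and solve the right invariant equation `g' =
β g` in `G` near the identity. Then `ρ(g)⁻¹ A` has derivative zero, so `A` stays in one coset of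
`ρ(G)` (`exists_eq_rep_mul_of_hasDerivWithinAt`), and connectedness of `[0, 1]` carries
admissibility from one end to the other.

Conversely, extend an admissible basis to parallel sections along a curve with prescribed initial
direction. Applying admissibility to every initial arc gives `A(t) ∈ ρ(G)` for all `t`, with `A(0) =
1` and `A'(0) = -ω(σ'(0))`. The difficulty is that `ρ(G)` need not be closed, so a lift of `A` to
`G` may a priori be discontinuous. But `G` is σ-compact, and Baire's theorem makes every lift
continuous at a dense set of times (`dense_continuousAt_lift`). At those times `A' A⁻¹ ∈ dρ(𝔤)`,
because `ρ` is an immersion. As `dρ(𝔤)` is closed, the limit at time `0` lies in it too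
(`mem_range_diffRep_of_curve`).

Part (2) follows from the structure equation `Ω = dω + ω ∧ ω`. Differentiating a function with
values in a linear subspace does not leave the subspace. The quadratic term is a commutator, the
derivative of `ρ(γ(t)) Y ρ(γ(t))⁻¹`, whose values lie in `dρ(𝔤)` by the same result on curves. -/

noncomputable section

/-! ### The group law and the representation in a chart around the identity -/

section LieGroupRepresentation

attribute [local instance] Matrix.linftyOpNormedRing Matrix.linftyOpNormedAlgebra

variable {EG : Type*} [NormedAddCommGroup EG] [NormedSpace ℝ EG]
  {G : Type*} [TopologicalSpace G] [ChartedSpace EG G] [Group G] {k : ℕ}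

variable (EG) in
/-- The representation `ρ` read in the preferred chart around the identity. -/
def chartRep (ρ : G →* GL (Fin k) ℝ) (u : EG) : Matrix (Fin k) (Fin k) ℝ :=
  (ρ ((extChartAt 𝓘(ℝ, EG) (1 : G)).symm u) : Matrix (Fin k) (Fin k) ℝ)

variable (EG G) in
/-- The coordinates of the identity in the preferred chart around it. -/
def chartOne : EG := extChartAt 𝓘(ℝ, EG) (1 : G) 1

variable (EG G) in
/-- The group multiplication read in the preferred chart around the identity. -/
def chartMul (p : EG × EG) : EG :=
  extChartAt 𝓘(ℝ, EG) (1 : G)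
    ((extChartAt 𝓘(ℝ, EG) (1 : G)).symm p.1 * (extChartAt 𝓘(ℝ, EG) (1 : G)).symm p.2)

@[simp] lemma symm_chartOne : (extChartAt 𝓘(ℝ, EG) (1 : G)).symm (chartOne EG G) = 1 :=
  extChartAt_to_inv 1

@[simp] lemma chartRep_chartOne (ρ : G →* GL (Fin k) ℝ) : chartRep EG ρ (chartOne EG G) = 1 := by
  rw [chartRep, symm_chartOne, map_one]
  rfl

lemma target_mem_nhds_chartOne :
    (extChartAt 𝓘(ℝ, EG) (1 : G)).target ∈ 𝓝 (chartOne EG G) :=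
  extChartAt_target_mem_nhds 1

lemma chartMul_one_left {u : EG} (hu : u ∈ (extChartAt 𝓘(ℝ, EG) (1 : G)).target) :
    chartMul EG G (chartOne EG G, u) = u := by
  simp only [chartMul, symm_chartOne, one_mul]
  exact (extChartAt 𝓘(ℝ, EG) (1 : G)).right_inv hu

lemma chartMul_one_right {u : EG} (hu : u ∈ (extChartAt 𝓘(ℝ, EG) (1 : G)).target) :
    chartMul EG G (u, chartOne EG G) = u := by
  simp only [chartMul, symm_chartOne, mul_one]
  exact (extChartAt 𝓘(ℝ, EG) (1 : G)).right_inv hu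

lemma contMDiffAt_chart_symm [IsManifold 𝓘(ℝ, EG) ∞ G] {u : EG}
    (hu : u ∈ (extChartAt 𝓘(ℝ, EG) (1 : G)).target) :
    ContMDiffAt 𝓘(ℝ, EG) 𝓘(ℝ, EG) ∞ (extChartAt 𝓘(ℝ, EG) (1 : G)).symm u :=
  (contMDiffOn_extChartAt_symm (1 : G)).contMDiffAt
    ((isOpen_extChartAt_target (1 : G)).mem_nhds hu)

lemma contDiffAt_chartRep [IsManifold 𝓘(ℝ, EG) ∞ G] {ρ : G →* GL (Fin k) ℝ}
    (hρ : IsSmoothRep (EG := EG) ρ) {u : EG}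
    (hu : u ∈ (extChartAt 𝓘(ℝ, EG) (1 : G)).target) :
    ContDiffAt ℝ ∞ (chartRep EG ρ) u := by
  have h : ∀ i j, ContDiffAt ℝ ∞ (fun u => chartRep EG ρ u i j) u := fun i j =>
    contMDiffAt_iff_contDiffAt.mp
      ((hρ i j).contMDiffAt.comp u (contMDiffAt_chart_symm hu))
  -- Smoothness is known for the entries, while matrices carry an operator norm; a finite
  -- combination of constant matrices passes from one to the other.
  have h2 : chartRep EG ρ = fun u => ∑ i, ∑ j, chartRep EG ρ u i j • Matrix.single i j (1 : ℝ) := by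
    ext u : 1
    conv_lhs => rw [Matrix.matrix_eq_sum_single (chartRep EG ρ u)]
    simp [Matrix.smul_single]
  rw [h2]
  exact ContDiffAt.sum fun i _ => ContDiffAt.sum fun j _ => (h i j).smul contDiffAt_const

/-- The tangent space at `1` is the model space `EG`, and the manifold derivative at `1` is by
definition the derivative read in the preferred chart. This identifies `dρ` with an ordinary Fréchet
derivative. -/
lemma fderiv_chartRep_apply [IsManifold 𝓘(ℝ, EG) ∞ G] {ρ : G →* GL (Fin k) ℝ}
    (hρ : IsSmoothRep (EG := EG) ρ) (h : EG) :
    fderiv ℝ (chartRep EG ρ) (chartOne EG G) h =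
      diffRep ρ (show GroupLieAlgebra 𝓘(ℝ, EG) G from h) := by
  have hd : DifferentiableAt ℝ (chartRep EG ρ) (chartOne EG G) :=
    (contDiffAt_chartRep hρ (mem_extChartAt_target 1)).differentiableAt (by simp)
  ext i j
  let P : Matrix (Fin k) (Fin k) ℝ →L[ℝ] ℝ :=
    LinearMap.toContinuousLinearMap
      { toFun := fun A => A i j, map_add' := fun _ _ => rfl, map_smul' := fun _ _ => rfl }
  have h1 : fderiv ℝ (fun u => chartRep EG ρ u i j) (chartOne EG G) h =
      fderiv ℝ (chartRep EG ρ) (chartOne EG G) h i j := by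
    have := (P.hasFDerivAt.comp (chartOne EG G) hd.hasFDerivAt).fderiv
    exact congrArg (fun L => L h) this
  rw [← h1]
  have hm : MDifferentiableAt 𝓘(ℝ, EG) 𝓘(ℝ, ℝ)
      (fun g : G => (ρ g : Matrix (Fin k) (Fin k) ℝ) i j) 1 :=
    (hρ i j).mdifferentiableAt (by simp)
  let D : EG →L[ℝ] ℝ :=
    mfderiv 𝓘(ℝ, EG) 𝓘(ℝ, ℝ) (fun g : G => (ρ g : Matrix (Fin k) (Fin k) ℝ) i j) 1
  have h2 : HasFDerivWithinAt (fun u => chartRep EG ρ u i j) D (Set.range 𝓘(ℝ, EG))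
      (chartOne EG G) := hm.hasMFDerivAt.2
  rw [modelWithCornersSelf_coe, Set.range_id, hasFDerivWithinAt_univ] at h2
  rw [h2.fderiv]
  rfl

lemma contDiffAt_chartMul [LieGroup 𝓘(ℝ, EG) ∞ G] :
    ContDiffAt ℝ ∞ (chartMul EG G) (chartOne EG G, chartOne EG G) := by
  rw [← contMDiffAt_iff_contDiffAt]
  have hu := mem_extChartAt_target (I := 𝓘(ℝ, EG)) (1 : G)
  have h1 : ContMDiffAt 𝓘(ℝ, EG × EG) 𝓘(ℝ, EG) ∞
      (fun p : EG × EG => (extChartAt 𝓘(ℝ, EG) (1 : G)).symm p.1)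
      (chartOne EG G, chartOne EG G) :=
    ContMDiffAt.comp (chartOne EG G, chartOne EG G) (contMDiffAt_chart_symm hu)
      contDiffAt_fst.contMDiffAt
  have h2 : ContMDiffAt 𝓘(ℝ, EG × EG) 𝓘(ℝ, EG) ∞
      (fun p : EG × EG => (extChartAt 𝓘(ℝ, EG) (1 : G)).symm p.2)
      (chartOne EG G, chartOne EG G) :=
    ContMDiffAt.comp (chartOne EG G, chartOne EG G) (contMDiffAt_chart_symm hu)
      contDiffAt_snd.contMDiffAt
  have h3 := h1.mul h2
  refine ContMDiffAt.comp (chartOne EG G, chartOne EG G) (I' := 𝓘(ℝ, EG)) ?_ h3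
  simp only [symm_chartOne, mul_one]
  exact contMDiffAt_extChartAt

lemma fderiv_chartMul_chartOne [LieGroup 𝓘(ℝ, EG) ∞ G] (h : EG) :
    fderiv ℝ (chartMul EG G) (chartOne EG G, chartOne EG G) (h, 0) = h := by
  have hd : DifferentiableAt ℝ (chartMul EG G) (chartOne EG G, chartOne EG G) :=
    contDiffAt_chartMul.differentiableAt (by simp)
  have h1 : HasFDerivAt (fun a => chartMul EG G (a, chartOne EG G)) _ (chartOne EG G) :=
    HasFDerivAt.comp (g := chartMul EG G) (f := fun a => (a, chartOne EG G)) (chartOne EG G)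
      hd.hasFDerivAt (hasFDerivAt_prodMk_left (𝕜 := ℝ) (chartOne EG G) (chartOne EG G))
  have h2 : HasFDerivAt (fun a => chartMul EG G (a, chartOne EG G))
      (ContinuousLinearMap.id ℝ EG) (chartOne EG G) := by
    refine (hasFDerivAt_id _).congr_of_eventuallyEq ?_
    filter_upwards [target_mem_nhds_chartOne (EG := EG) (G := G)] with a ha
    exact chartMul_one_right ha
  exact congrArg (fun L : EG →L[ℝ] EG => L h) (h1.unique h2)

/-- Differentiate `ρ(a u) = ρ(a) ρ(u)` in `a` at `a = 1`. The vector to which the left side is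
applied is the value at `u` of the right invariant field through `h`, so `ρ` sends solutions of `g'
= h g` to solutions of `A' = dρ(h) A`. -/
lemma eventually_fderiv_chartRep_fderiv_chartMul [LieGroup 𝓘(ℝ, EG) ∞ G]
    {ρ : G →* GL (Fin k) ℝ} (hρ : IsSmoothRep (EG := EG) ρ) :
    ∀ᶠ u in 𝓝 (chartOne EG G), ∀ h : EG,
      fderiv ℝ (chartRep EG ρ) u (fderiv ℝ (chartMul EG G) (chartOne EG G, u) (h, 0)) =
        fderiv ℝ (chartRep EG ρ) (chartOne EG G) h * chartRep EG ρ u := by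
  have : IsTopologicalGroup G := topologicalGroup_of_lieGroup 𝓘(ℝ, EG) ∞
  have hT := target_mem_nhds_chartOne (EG := EG) (G := G)
  have hcont : Filter.Tendsto (fun u : EG => (chartOne EG G, u)) (𝓝 (chartOne EG G))
      (𝓝 (chartOne EG G, chartOne EG G)) :=
    (Continuous.prodMk_right (chartOne EG G)).tendsto _
  have hdm : ∀ᶠ u in 𝓝 (chartOne EG G),
      DifferentiableAt ℝ (chartMul EG G) (chartOne EG G, u) := by
    have h1 : ∀ᶠ p in 𝓝 (chartOne EG G, chartOne EG G),
        ContDiffAt ℝ 1 (chartMul EG G) p :=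
      ((contDiffAt_chartMul (EG := EG) (G := G)).of_le (m := 1) (by simp)).eventually (by simp)
    filter_upwards [hcont.eventually h1] with u hu using hu.differentiableAt (by simp)
  have hsrc : ∀ᶠ p : EG × EG in 𝓝 (chartOne EG G, chartOne EG G),
      (extChartAt 𝓘(ℝ, EG) (1 : G)).symm p.1 * (extChartAt 𝓘(ℝ, EG) (1 : G)).symm p.2 ∈
        (extChartAt 𝓘(ℝ, EG) (1 : G)).source := by
    have hs : ContinuousAt (extChartAt 𝓘(ℝ, EG) (1 : G)).symm (chartOne EG G) :=
      continuousAt_extChartAt_symm 1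
    have hc : ContinuousAt (fun p : EG × EG => (extChartAt 𝓘(ℝ, EG) (1 : G)).symm p.1 *
        (extChartAt 𝓘(ℝ, EG) (1 : G)).symm p.2) (chartOne EG G, chartOne EG G) :=
      (ContinuousAt.comp (x := (chartOne EG G, chartOne EG G)) (f := Prod.fst) hs
        continuousAt_fst).mul
      (ContinuousAt.comp (x := (chartOne EG G, chartOne EG G)) (f := Prod.snd) hs
        continuousAt_snd)
    refine hc.eventually_mem ?_
    simp only [symm_chartOne, mul_one]
    exact extChartAt_source_mem_nhds 1
  -- `eventually_nhds` makes the product stay in the chart on a whole neighbourhood of `(1, u)`, as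
  -- needed to differentiate in the first variable with `u` fixed.
  filter_upwards [hdm, hT, hcont.eventually hsrc.eventually_nhds] with u hd hu hs h
  have hm : HasFDerivAt (fun a => chartMul EG G (a, u)) _ (chartOne EG G) :=
    HasFDerivAt.comp (g := chartMul EG G) (f := fun a => (a, u)) (chartOne EG G)
      hd.hasFDerivAt (hasFDerivAt_prodMk_left (𝕜 := ℝ) (chartOne EG G) u)
  have hR : HasFDerivAt (chartRep EG ρ) (fderiv ℝ (chartRep EG ρ) u)
      (chartMul EG G (chartOne EG G, u)) := by
    rw [chartMul_one_left hu]
    exact ((contDiffAt_chartRep hρ hu).differentiableAt (by simp)).hasFDerivAt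
  have h1 := hR.comp (chartOne EG G) hm
  have hR0 : HasFDerivAt (chartRep EG ρ) (fderiv ℝ (chartRep EG ρ) (chartOne EG G))
      (chartOne EG G) :=
    ((contDiffAt_chartRep hρ (mem_extChartAt_target 1)).differentiableAt (by simp)).hasFDerivAt
  have h2 := hR0.mul_const' (chartRep EG ρ u)
  have hcont' : Filter.Tendsto (fun a : EG => (a, u)) (𝓝 (chartOne EG G))
      (𝓝 (chartOne EG G, u)) :=
    (Continuous.prodMk_left u).tendsto _
  have h3 : (chartRep EG ρ ∘ fun a => chartMul EG G (a, u)) =ᶠ[𝓝 (chartOne EG G)]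
      fun a => chartRep EG ρ a * chartRep EG ρ u := by
    filter_upwards [hcont'.eventually hs] with a ha
    simp only [Function.comp, chartRep, chartMul]
    rw [(extChartAt 𝓘(ℝ, EG) (1 : G)).left_inv ha, map_mul]
    rfl
  have h4 := (h1.congr_of_eventuallyEq h3.symm).unique h2
  exact congrArg (fun L : EG →L[ℝ] Matrix (Fin k) (Fin k) ℝ => L h) h4

end LieGroupRepresentation

/-! ### Local solutions of right invariant equations; injective representations are immersions -/

section LocalSolutions

/-- Local solvability of `u' = Λ(u) β(t)` with `Λ` of class `C¹` and `β` continuous. -/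
lemma exists_hasDerivAt_clm_apply {E F : Type*} [NormedAddCommGroup E] [NormedSpace ℝ E]
    [CompleteSpace E] [NormedAddCommGroup F] [NormedSpace ℝ F] {Λ : E → F →L[ℝ] E} {u₀ : E}
    (hΛ : ContDiffAt ℝ 1 Λ u₀) {β : ℝ → F} (hβ : Continuous β) (t₀ : ℝ) :
    ∃ u : ℝ → E, u t₀ = u₀ ∧ ∀ᶠ t in 𝓝 t₀, HasDerivAt u (Λ (u t) (β t)) t := by
  obtain ⟨K, s, hs, hK⟩ := hΛ.exists_lipschitzOnWith
  obtain ⟨a, ha, has⟩ := Metric.nhds_basis_closedBall.mem_iff.mp hs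
  obtain ⟨C, hC⟩ := (isCompact_Icc (a := t₀ - 1) (b := t₀ + 1)).exists_bound_of_continuousOn
    hβ.continuousOn
  have hC0 : 0 ≤ C := (norm_nonneg _).trans (hC t₀ (by simp))
  lift C to NNReal using hC0
  have hu₀ : u₀ ∈ s := has (Metric.mem_closedBall_self ha.le)
  set N : ℝ := ‖Λ u₀‖ + K * a with hN
  have hN0 : 0 ≤ N := by positivity
  have hΛN : ∀ u ∈ Metric.closedBall u₀ a, ‖Λ u‖ ≤ N := by
    intro u hu
    have h1 : ‖Λ u - Λ u₀‖ ≤ K * a := by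
      have h2 := hK.dist_le_mul u (has hu) u₀ hu₀
      rw [dist_eq_norm] at h2
      exact h2.trans (mul_le_mul_of_nonneg_left hu K.2)
    calc ‖Λ u‖ = ‖Λ u₀ + (Λ u - Λ u₀)‖ := by simp
      _ ≤ ‖Λ u₀‖ + ‖Λ u - Λ u₀‖ := norm_add_le _ _
      _ ≤ N := by rw [hN]; gcongr
  set L : ℝ := N * C with hL
  have hL0 : 0 ≤ L := by positivity
  -- The bound `C` on `β` is valid up to time distance `1`. A curve of speed at most `L` stays in
  -- the ball of radius `a` when `L ε ≤ a`; the denominator `L + 1` allows `L = 0`.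
  set ε : ℝ := min 1 (a / (L + 1)) with hε
  have hε0 : 0 < ε := by positivity
  have hsub : Icc (t₀ - ε) (t₀ + ε) ⊆ Icc (t₀ - 1) (t₀ + 1) := by
    have : ε ≤ 1 := min_le_left _ _
    exact Icc_subset_Icc (by linarith) (by linarith)
  have hPL : IsPicardLindelof (fun t u => Λ u (β t)) (tmin := t₀ - ε) (tmax := t₀ + ε)
      ⟨t₀, by constructor <;> linarith⟩ u₀ ⟨a, ha.le⟩ 0 ⟨L, hL0⟩ (K * C) := by
    constructor
    · intro t ht
      refine LipschitzOnWith.of_dist_le_mul fun u hu v hv => ?_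
      have h2 := hK.dist_le_mul u (has hu) v (has hv)
      rw [dist_eq_norm, ← sub_apply]
      calc ‖(Λ u - Λ v) (β t)‖ ≤ ‖Λ u - Λ v‖ * ‖β t‖ := ContinuousLinearMap.le_opNorm _ _
        _ ≤ (K * dist u v) * C := by
          rw [dist_eq_norm] at h2
          gcongr
          exact hC t (hsub ht)
        _ = _ := by simp only [NNReal.coe_mul]; ring
    · intro u _
      exact ((Λ u).continuous.comp hβ).continuousOn
    · intro t ht u hu
      calc ‖Λ u (β t)‖ ≤ ‖Λ u‖ * ‖β t‖ := ContinuousLinearMap.le_opNorm _ _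
        _ ≤ N * C := by
          gcongr
          · exact hΛN u hu
          · exact hC t (hsub ht)
    · have h1 : max (t₀ + ε - t₀) (t₀ - (t₀ - ε)) = ε := by simp
      simp only [h1, NNReal.coe_zero, sub_zero]
      calc L * ε ≤ L * (a / (L + 1)) := by gcongr; exact min_le_right _ _
        _ = a * (L / (L + 1)) := by ring
        _ ≤ a * 1 := by
          gcongr
          rw [div_le_one (by positivity)]
          linarith
        _ = a := mul_one a
  obtain ⟨u, hu0, hu⟩ := hPL.exists_eq_forall_mem_Icc_hasDerivWithinAt₀
  refine ⟨u, hu0, ?_⟩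
  filter_upwards [Ioo_mem_nhds (show t₀ - ε < t₀ by linarith) (show t₀ < t₀ + ε by linarith)]
    with t ht
  exact (hu t (Ioo_subset_Icc_self ht)).hasDerivAt (Icc_mem_nhds ht.1 ht.2)

attribute [local instance] Matrix.linftyOpNormedRing Matrix.linftyOpNormedAlgebra

variable {EG : Type*} [NormedAddCommGroup EG] [NormedSpace ℝ EG] [FiniteDimensional ℝ EG]
  {G : Type*} [TopologicalSpace G] [ChartedSpace EG G] [Group G] [LieGroup 𝓘(ℝ, EG) ∞ G] {k : ℕ}

/-- The right invariant equation `g' = β(t) g` on the group has local solutions through the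
identity. They are given in the chart around the identity. -/
lemma exists_hasDerivAt_chartRep {ρ : G →* GL (Fin k) ℝ} (hρ : IsSmoothRep (EG := EG) ρ)
    {β : ℝ → EG} (hβ : Continuous β) (t₀ : ℝ) :
    ∃ u : ℝ → EG, u t₀ = chartOne EG G ∧ HasDerivAt u (β t₀) t₀ ∧
      ∀ᶠ t in 𝓝 t₀, u t ∈ (extChartAt 𝓘(ℝ, EG) (1 : G)).target ∧
        HasDerivAt (fun t => chartRep EG ρ (u t))
          (fderiv ℝ (chartRep EG ρ) (chartOne EG G) (β t) * chartRep EG ρ (u t)) t := by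
  have : CompleteSpace EG := FiniteDimensional.complete ℝ EG
  -- `Λ u h` is the value at `u` of the right invariant vector field through `h`.
  let Λ : EG → EG →L[ℝ] EG := fun u =>
    (fderiv ℝ (chartMul EG G) (chartOne EG G, u)).comp (ContinuousLinearMap.inl ℝ EG EG)
  have hΛ : ContDiffAt ℝ 1 Λ (chartOne EG G) := by
    have h1 : ContDiffAt ℝ 1 (fderiv ℝ (chartMul EG G)) (chartOne EG G, chartOne EG G) :=
      contDiffAt_chartMul.fderiv_right (by norm_cast)
    have h2 : ContDiffAt ℝ 1 (fun u : EG => (chartOne EG G, u)) (chartOne EG G) :=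
      contDiffAt_const.prodMk contDiffAt_id
    exact (ContDiffAt.comp (chartOne EG G) h1 h2).clm_comp contDiffAt_const
  obtain ⟨u, hu0, hu⟩ := exists_hasDerivAt_clm_apply hΛ hβ t₀
  have hu' : HasDerivAt u (β t₀) t₀ := by
    have h1 := hu.self_of_nhds
    rw [hu0] at h1
    have h2 : Λ (chartOne EG G) (β t₀) = β t₀ := by
      simpa [Λ] using fderiv_chartMul_chartOne (β t₀)
    rwa [h2] at h1
  refine ⟨u, hu0, hu', ?_⟩
  have hcont : Filter.Tendsto u (𝓝 t₀) (𝓝 (chartOne EG G)) := by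
    have := hu'.continuousAt.tendsto
    rwa [hu0] at this
  filter_upwards [hu, hcont.eventually (eventually_fderiv_chartRep_fderiv_chartMul hρ),
    hcont.eventually (target_mem_nhds_chartOne (G := G))] with t h1 h2 h3
  refine ⟨h3, ?_⟩
  have h4 := ((contDiffAt_chartRep hρ h3).differentiableAt (by simp)).hasFDerivAt.comp_hasDerivAt
    t h1
  have h5 := h2 (β t)
  rw [← h5]
  exact h4

/-- A smooth injective representation is an immersion at the identity. -/
lemma fderiv_chartRep_injective {ρ : G →* GL (Fin k) ℝ} (hρ : IsSmoothRep (EG := EG) ρ)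
    (hinj : Function.Injective ρ) :
    Function.Injective (fderiv ℝ (chartRep EG ρ) (chartOne EG G)) := by
  rw [injective_iff_map_eq_zero]
  intro X hX
  -- If `dρ(X) = 0`, then `ρ` is constant along the integral curve of the right invariant field of
  -- `X`. Injectivity makes the curve itself constant, although its initial velocity is `X`.
  obtain ⟨u, hu0, hu', hu⟩ := exists_hasDerivAt_chartRep hρ (β := fun _ => X) continuous_const 0
  simp only [hX, zero_mul] at hu
  obtain ⟨ε, hε, hball⟩ := Metric.eventually_nhds_iff_ball.mp hu
  have hconst : ∀ t ∈ Metric.ball (0 : ℝ) ε, u t = chartOne EG G := by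
    intro t ht
    have h1 := (convex_ball (0 : ℝ) ε).norm_image_sub_le_of_norm_hasDerivWithin_le (C := 0)
      (fun s hs => (hball s hs).2.hasDerivWithinAt) (by simp) (Metric.mem_ball_self hε) ht
    rw [zero_mul] at h1
    have h2 : chartRep EG ρ (u t) = 1 := by
      have := sub_eq_zero.mp (norm_le_zero_iff.mp h1)
      rw [this, hu0, chartRep_chartOne]
    have h3 : (extChartAt 𝓘(ℝ, EG) (1 : G)).symm (u t) = 1 := by
      apply hinj
      rw [map_one]
      exact Units.ext h2
    rw [← (extChartAt 𝓘(ℝ, EG) (1 : G)).right_inv (hball t ht).1, h3]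
    rfl
  have h4 : HasDerivAt u 0 0 := by
    refine (hasDerivAt_const (0 : ℝ) (chartOne EG G)).congr_of_eventuallyEq ?_
    filter_upwards [Metric.ball_mem_nhds (0 : ℝ) hε] with t ht using hconst t ht
  exact hu'.unique h4

end LocalSolutions

/-! ### Velocities of curves in the possibly non-closed image of `ρ` -/

section RangeOfRepresentation

attribute [local instance] Matrix.linftyOpNormedRing Matrix.linftyOpNormedAlgebra

variable {EG : Type*} [NormedAddCommGroup EG] [NormedSpace ℝ EG] [FiniteDimensional ℝ EG]
  {G : Type*} [TopologicalSpace G] [ChartedSpace EG G] [Group G] [LieGroup 𝓘(ℝ, EG) ∞ G] {k : ℕ}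
  {ρ : G →* GL (Fin k) ℝ}

omit [FiniteDimensional ℝ EG] in
lemma mem_range_diffRep_iff (hρ : IsSmoothRep (EG := EG) ρ) {L : Matrix (Fin k) (Fin k) ℝ} :
    L ∈ LinearMap.range (diffRep (EG := EG) ρ) ↔
      ∃ h : EG, fderiv ℝ (chartRep EG ρ) (chartOne EG G) h = L := by
  constructor
  · rintro ⟨h, rfl⟩
    exact ⟨h, fderiv_chartRep_apply hρ h⟩
  · rintro ⟨h, rfl⟩
    exact ⟨h, (fderiv_chartRep_apply hρ h).symm⟩

omit [LieGroup 𝓘(ℝ, EG) ∞ G] [FiniteDimensional ℝ EG] in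
lemma IsSmoothRep.continuous_coe (hρ : IsSmoothRep (EG := EG) ρ) :
    Continuous fun g : G => (ρ g : Matrix (Fin k) (Fin k) ℝ) :=
  continuous_matrix fun i j => (hρ i j).continuous

/-- The derivative at the identity of a curve in the image of `ρ` which lifts to a continuous curve
in the group lies in the Lie algebra. -/
lemma mem_range_diffRep_of_continuousAt_lift (hρ : IsSmoothRep (EG := EG) ρ)
    (hinj : Function.Injective ρ) {γ : ℝ → G} {t₁ : ℝ} (hγ : ContinuousAt γ t₁) (hγ1 : γ t₁ = 1)
    {D : Matrix (Fin k) (Fin k) ℝ}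
    (hD : HasDerivAt (fun t => (ρ (γ t) : Matrix (Fin k) (Fin k) ℝ)) D t₁) :
    D ∈ LinearMap.range (diffRep (EG := EG) ρ) := by
  have : CompleteSpace EG := FiniteDimensional.complete ℝ EG
  rw [mem_range_diffRep_iff hρ]
  set u₀ := chartOne EG G with hu₀
  set L₀ := fderiv ℝ (chartRep EG ρ) u₀ with hL₀
  have hker : LinearMap.ker (L₀ : EG →ₗ[ℝ] Matrix (Fin k) (Fin k) ℝ) = ⊥ :=
    LinearMap.ker_eq_bot.mpr (fderiv_chartRep_injective hρ hinj)
  obtain ⟨P, hP⟩ := LinearMap.exists_leftInverse_of_injective _ hker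
  let P' : Matrix (Fin k) (Fin k) ℝ →L[ℝ] EG := LinearMap.toContinuousLinearMap P
  have hR : HasStrictFDerivAt (chartRep EG ρ) L₀ u₀ :=
    (contDiffAt_chartRep hρ (mem_extChartAt_target 1)).hasStrictFDerivAt (by simp)
  -- Composed with a left inverse of `dρ`, the representation has derivative the identity. Its local
  -- inverse recovers the chart coordinates of `γ t` from `ρ (γ t)` as long as `γ t` is near `1`,
  -- which is where continuity of `γ` enters. Hence these coordinates are differentiable.
  have hPR : HasStrictFDerivAt (fun u => P' (chartRep EG ρ u))
      (ContinuousLinearEquiv.refl ℝ EG : EG →L[ℝ] EG) u₀ := by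
    have h1 := P'.hasStrictFDerivAt.comp u₀ hR
    have h2 : P'.comp L₀ = (ContinuousLinearEquiv.refl ℝ EG : EG →L[ℝ] EG) := by
      ext x
      exact LinearMap.congr_fun hP x
    rw [← h2]
    exact h1
  let u : ℝ → EG := fun t => extChartAt 𝓘(ℝ, EG) (1 : G) (γ t)
  have hγ' : Filter.Tendsto γ (𝓝 t₁) (𝓝 1) := hγ1 ▸ hγ.tendsto
  have hu : Filter.Tendsto u (𝓝 t₁) (𝓝 u₀) :=
    (continuousAt_extChartAt (I := 𝓘(ℝ, EG)) (1 : G)).tendsto.comp hγ'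
  have hRu : ∀ᶠ t in 𝓝 t₁, chartRep EG ρ (u t) = ρ (γ t) := by
    filter_upwards [hγ'.eventually (extChartAt_source_mem_nhds (I := 𝓘(ℝ, EG)) (1 : G))] with t ht
    rw [chartRep, (extChartAt 𝓘(ℝ, EG) (1 : G)).left_inv ht]
  have hinv := hu.eventually hPR.eventually_left_inverse
  have hu1 : u t₁ = u₀ := by simp only [u, hγ1]; rfl
  have hρ1 : (ρ (γ t₁) : Matrix (Fin k) (Fin k) ℝ) = chartRep EG ρ u₀ := by
    rw [hγ1, map_one, hu₀, chartRep_chartOne]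
    rfl
  have hPD : HasDerivAt (fun t => P' (ρ (γ t) : Matrix (Fin k) (Fin k) ℝ)) (P' D) t₁ :=
    P'.hasFDerivAt.comp_hasDerivAt t₁ hD
  have hg := hPR.to_localInverse.hasFDerivAt
  have hderiv : HasDerivAt u (P' D) t₁ := by
    have h1 : HasFDerivAt (hPR.localInverse _ _ _)
        ((ContinuousLinearEquiv.refl ℝ EG).symm : EG →L[ℝ] EG) (P' (ρ (γ t₁) : Matrix (Fin k) (Fin k) ℝ)) := by
      rw [hρ1]
      exact hg
    refine (h1.comp_hasDerivAt t₁ hPD).congr_of_eventuallyEq ?_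
    filter_upwards [hinv, hRu] with t h2 h3
    simp only [Function.comp]
    rw [← h3, h2]
  have hR' : HasFDerivAt (chartRep EG ρ) L₀ (u t₁) := by rw [hu1]; exact hR.hasFDerivAt
  have hfin := (hR'.comp_hasDerivAt t₁ hderiv).congr_of_eventuallyEq
    (f₁ := fun t => (ρ (γ t) : Matrix (Fin k) (Fin k) ℝ)) (by
      filter_upwards [hRu] with t ht using ht.symm)
  exact ⟨P' D, hfin.unique hD⟩

omit [LieGroup 𝓘(ℝ, EG) ∞ G] in
/-- A continuous curve whose values lie in the injective image of a `σ`-compact group lifts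
continuously near a dense set of times. -/
lemma dense_continuousAt_lift [T2Space G] [SecondCountableTopology G]
    (hρ : IsSmoothRep (EG := EG) ρ) (hinj : Function.Injective ρ) {γ : ℝ → G}
    (hγ : Continuous fun t => (ρ (γ t) : Matrix (Fin k) (Fin k) ℝ)) :
    Dense {t | ContinuousAt γ t} := by
  have : LocallyCompactSpace G := ChartedSpace.locallyCompactSpace EG G
  have hinj' : Function.Injective fun g : G => (ρ g : Matrix (Fin k) (Fin k) ℝ) :=
    fun g g' h => hinj (Units.ext h)
  let K := compactCovering G
  have hK : ∀ n, IsCompact (K n) := isCompact_compactCovering G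
  -- The times at which the lift lies in the `n`-th compact set. They form a closed set, because by
  -- injectivity of `ρ` they are the preimage of a compact set of matrices under a continuous curve.
  let C : ℕ → Set ℝ := fun n => {t | γ t ∈ K n}
  have hCeq : ∀ n, C n = (fun t => (ρ (γ t) : Matrix (Fin k) (Fin k) ℝ)) ⁻¹'
      ((fun g : G => (ρ g : Matrix (Fin k) (Fin k) ℝ)) '' K n) := by
    intro n
    ext t
    simp only [C, mem_ofPred_eq, mem_preimage]
    rw [hinj'.mem_set_image (a := γ t)]
  have hC : ∀ n, IsClosed (C n) := fun n => by
    rw [hCeq]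
    exact ((hK n).image hρ.continuous_coe).isClosed.preimage hγ
  have hU : ⋃ n, C n = univ := by
    ext t
    simp only [C, mem_iUnion, mem_ofPred_eq, mem_univ, iff_true]
    have := mem_univ (γ t)
    rw [← iUnion_compactCovering G] at this
    exact mem_iUnion.mp this
  -- Baire's theorem: near a dense set of times the lift stays in one compact set, on which `ρ` is a
  -- homeomorphism onto its image.
  refine (dense_iUnion_interior_of_closed hC hU).mono ?_
  rintro t ht
  obtain ⟨n, hn⟩ := mem_iUnion.mp ht
  have hn' : ∀ᶠ s in 𝓝 t, γ s ∈ K n := mem_interior_iff_mem_nhds.mp hn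
  intro W hW
  -- The part of the compact set outside a neighbourhood of `γ t` has a closed image missing `ρ (γ
  -- t)`; by continuity, this image is also missed at nearby times.
  have hcl : IsClosed ((fun g : G => (ρ g : Matrix (Fin k) (Fin k) ℝ)) '' (K n \ interior W)) :=
    (((hK n).diff isOpen_interior).image hρ.continuous_coe).isClosed
  have hnot : (ρ (γ t) : Matrix (Fin k) (Fin k) ℝ) ∉
      (fun g : G => (ρ g : Matrix (Fin k) (Fin k) ℝ)) '' (K n \ interior W) := by
    intro h
    rw [hinj'.mem_set_image (a := γ t)] at h
    exact h.2 (mem_interior_iff_mem_nhds.mpr hW)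
  change ∀ᶠ s in 𝓝 t, γ s ∈ W
  filter_upwards [hn', hγ.continuousAt.eventually (hcl.isOpen_compl.mem_nhds hnot)] with s h1 h2
  by_contra h3
  exact h2 ⟨γ s, ⟨h1, fun h => h3 (interior_subset h)⟩, rfl⟩

/-- The initial velocity of a `C¹` curve starting from the identity, with values in the image of
`ρ`, lies in the Lie algebra. The image of `ρ` need not be closed. -/
lemma mem_range_diffRep_of_curve [T2Space G] [SecondCountableTopology G]
    (hρ : IsSmoothRep (EG := EG) ρ) (hinj : Function.Injective ρ)
    {A A' : ℝ → Matrix (Fin k) (Fin k) ℝ} {D : Matrix (Fin k) (Fin k) ℝ} {δ : ℝ} (hδ : 0 < δ)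
    (hcont : ContinuousOn A (Icc 0 δ)) (hA : ∀ t ∈ Ioo 0 δ, HasDerivAt A (A' t) t)
    (hA' : Filter.Tendsto A' (𝓝[>] 0) (𝓝 D)) (hA0 : A 0 = 1)
    (hmem : ∀ t ∈ Icc 0 δ, ∃ g : G, A t = ρ g) :
    D ∈ LinearMap.range (diffRep (EG := EG) ρ) := by
  have : IsTopologicalGroup G := topologicalGroup_of_lieGroup 𝓘(ℝ, EG) ∞
  choose! γ₀ hγ₀ using hmem
  -- An arbitrary pointwise lift, with no continuity, extended by its end values so that Baire's
  -- theorem applies on the whole line.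
  let γ : ℝ → G := fun t => γ₀ (projIcc 0 δ hδ.le t)
  have hγ : ∀ t, A (projIcc 0 δ hδ.le t) = ρ (γ t) := fun t => hγ₀ _ (projIcc 0 δ hδ.le t).2
  have hγ' : ∀ t ∈ Icc 0 δ, A t = ρ (γ t) := fun t ht => by
    rw [← hγ, projIcc_of_mem hδ.le ht]
  have hc : Continuous fun t => (ρ (γ t) : Matrix (Fin k) (Fin k) ℝ) := by
    simp_rw [← hγ]
    exact hcont.comp_continuous (continuous_subtype_val.comp continuous_projIcc) fun t =>
      (projIcc 0 δ hδ.le t).2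
  have hdense := dense_continuousAt_lift hρ hinj hc
  -- Where the lift is continuous, right translation by `(γ t)⁻¹` moves the question to the
  -- identity.
  have hkey : ∀ t ∈ Ioo 0 δ, ContinuousAt γ t →
      A' t * Ring.inverse (A t) ∈ LinearMap.range (diffRep (EG := EG) ρ) := by
    intro t ht hct
    have h1 : Ring.inverse (A t) = ρ (γ t)⁻¹ := by
      rw [hγ' t (Ioo_subset_Icc_self ht), Ring.inverse_unit, map_inv]
    rw [h1]
    refine mem_range_diffRep_of_continuousAt_lift hρ hinj (γ := fun s => γ s * (γ t)⁻¹) (t₁ := t)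
      (hct.mul continuousAt_const) (mul_inv_cancel _) ?_
    refine ((hA t ht).mul_const (ρ (γ t)⁻¹ : Matrix (Fin k) (Fin k) ℝ)).congr_of_eventuallyEq ?_
    filter_upwards [Ioo_mem_nhds ht.1 ht.2] with s hs
    rw [hγ' s (Ioo_subset_Icc_self hs), map_mul]
    rfl
  have hlim : Filter.Tendsto (fun t => A' t * Ring.inverse (A t)) (𝓝[>] 0) (𝓝 D) := by
    have h1 : Filter.Tendsto A (𝓝[>] 0) (𝓝 1) := by
      have h2 : ContinuousWithinAt A (Icc 0 δ) 0 := hcont 0 ⟨le_rfl, hδ.le⟩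
      rw [← hA0]
      refine h2.tendsto.mono_left ?_
      rw [← nhdsWithin_Ioo_eq_nhdsGT hδ]
      exact nhdsWithin_mono _ Ioo_subset_Icc_self
    have h3 : Filter.Tendsto (fun t => Ring.inverse (A t)) (𝓝[>] 0) (𝓝 1) := by
      have := (NormedRing.inverse_continuousAt
        (1 : (Matrix (Fin k) (Fin k) ℝ)ˣ)).tendsto.comp h1
      rw [Units.val_one, Ring.inverse_one] at this
      exact this
    simpa using hA'.mul h3
  -- Time `0` need not be a continuity time of the lift, so `D` is only reached as a limit of
  -- elements of the closed subspace.
  have hclosed : IsClosed (LinearMap.range (diffRep (EG := EG) ρ) :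
      Set (Matrix (Fin k) (Fin k) ℝ)) := Submodule.closed_of_finiteDimensional _
  refine hclosed.mem_of_frequently_of_tendsto ?_ hlim
  rw [Filter.frequently_iff]
  intro W hW
  obtain ⟨η, hη, hηW⟩ := mem_nhdsGT_iff_exists_Ioo_subset.mp hW
  have hmin : (0 : ℝ) < min η δ := lt_min hη hδ
  obtain ⟨t, ht, hct⟩ := hdense.inter_open_nonempty (Ioo 0 (min η δ)) isOpen_Ioo
    (nonempty_Ioo.mpr hmin)
  exact ⟨t, hηW ⟨ht.1, ht.2.trans_le (min_le_left _ _)⟩,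
    hkey t ⟨ht.1, ht.2.trans_le (min_le_right _ _)⟩ hct⟩

end RangeOfRepresentation

/-! ### Linear equations with coefficients in the Lie algebra; adjoint action and commutators -/

section LieAlgebraOfRepresentation

attribute [local instance] Matrix.linftyOpNormedRing Matrix.linftyOpNormedAlgebra

/-- Derivative of the inverse of a differentiable curve of invertible elements. -/
lemma HasDerivWithinAt.ringInverse {R : Type*} [NormedRing R] [NormedAlgebra ℝ R] [CompleteSpace R]
    {f : ℝ → R} {f' : R} {s : Set ℝ} {t : ℝ} (hf : HasDerivWithinAt f f' s t)
    (ht : IsUnit (f t)) :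
    HasDerivWithinAt (fun τ => Ring.inverse (f τ))
      (-(Ring.inverse (f t) * f' * Ring.inverse (f t))) s t := by
  obtain ⟨x, hx⟩ := ht
  have h1 := hasFDerivAt_ringInverse (𝕜 := ℝ) x
  rw [hx] at h1
  have h2 := h1.comp_hasDerivWithinAt t hf
  rw [← hx, Ring.inverse_unit]
  refine h2.congr_deriv ?_
  rw [neg_apply, ContinuousLinearMap.mulLeftRight_apply]

variable {EG : Type*} [NormedAddCommGroup EG] [NormedSpace ℝ EG] [FiniteDimensional ℝ EG]
  {G : Type*} [TopologicalSpace G] [ChartedSpace EG G] [Group G] [LieGroup 𝓘(ℝ, EG) ∞ G] {k : ℕ}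
  {ρ : G →* GL (Fin k) ℝ}

/-- Local solutions of `A' = B A` in the group, for a curve `B` in the Lie algebra. -/
lemma exists_hasDerivAt_rep (hρ : IsSmoothRep (EG := EG) ρ) (hinj : Function.Injective ρ)
    {B : ℝ → Matrix (Fin k) (Fin k) ℝ} (hB : Continuous B)
    (hmem : ∀ t, B t ∈ LinearMap.range (diffRep (EG := EG) ρ)) (t₀ : ℝ) :
    ∃ γ : ℝ → G, γ t₀ = 1 ∧ ∀ᶠ t in 𝓝 t₀,
      HasDerivAt (fun t => (ρ (γ t) : Matrix (Fin k) (Fin k) ℝ)) (B t * ρ (γ t)) t := by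
  have hker : LinearMap.ker (fderiv ℝ (chartRep EG ρ) (chartOne EG G) :
      EG →ₗ[ℝ] Matrix (Fin k) (Fin k) ℝ) = ⊥ :=
    LinearMap.ker_eq_bot.mpr (fderiv_chartRep_injective hρ hinj)
  obtain ⟨P, hP⟩ := LinearMap.exists_leftInverse_of_injective _ hker
  -- A linear left inverse of `dρ` lifts the curve `B` to a curve in the Lie algebra that is still
  -- continuous.
  let P' : Matrix (Fin k) (Fin k) ℝ →L[ℝ] EG := LinearMap.toContinuousLinearMap P
  have hPB : ∀ t, fderiv ℝ (chartRep EG ρ) (chartOne EG G) (P' (B t)) = B t := by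
    intro t
    obtain ⟨h, hh⟩ := (mem_range_diffRep_iff hρ).mp (hmem t)
    rw [← hh]
    congr 1
    exact LinearMap.congr_fun hP h
  obtain ⟨u, hu0, -, hu⟩ := exists_hasDerivAt_chartRep hρ (P'.continuous.comp hB) t₀
  refine ⟨fun t => (extChartAt 𝓘(ℝ, EG) (1 : G)).symm (u t), by simp only [hu0, symm_chartOne], ?_⟩
  filter_upwards [hu] with t ht
  have := ht.2
  simp only [Function.comp, hPB] at this
  exact this

/-- Solutions of `A' = B A` with `B` in the Lie algebra stay in one coset of the group. -/
lemma exists_eq_rep_mul_of_hasDerivWithinAt (hρ : IsSmoothRep (EG := EG) ρ)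
    (hinj : Function.Injective ρ) {A B : ℝ → Matrix (Fin k) (Fin k) ℝ} {a b : ℝ}
    (hB : ContinuousOn B (Icc a b))
    (hmem : ∀ t ∈ Icc a b, B t ∈ LinearMap.range (diffRep (EG := EG) ρ))
    (hA : ∀ t ∈ Icc a b, HasDerivWithinAt A (B t * A t) (Icc a b) t)
    {t t' : ℝ} (ht : t ∈ Icc a b) (ht' : t' ∈ Icc a b) :
    ∃ g : G, A t' = ρ g * A t := by
  have hab : a ≤ b := ht.1.trans ht.2
  -- Lying in the same left-multiplication orbit `ρ(G) A` is an equivalence relation on times, so on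
  -- an interval it is enough to prove it locally.
  refine isPreconnected_Icc.induction₂ (fun t t' => ∃ g : G, A t' = ρ g * A t) ?_ ?_ ?_ ht ht'
  · intro t₀ ht₀
    let B' : ℝ → Matrix (Fin k) (Fin k) ℝ := fun t => B (projIcc a b hab t)
    have hB' : Continuous B' :=
      hB.comp_continuous (continuous_subtype_val.comp continuous_projIcc) fun t =>
        (projIcc a b hab t).2
    obtain ⟨γ, hγ0, hγ⟩ := exists_hasDerivAt_rep hρ hinj hB'
      (fun t => hmem _ (projIcc a b hab t).2) t₀
    obtain ⟨ε, hε, hball⟩ := Metric.eventually_nhds_iff_ball.mp hγ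
    have hconv : Convex ℝ (Icc a b ∩ Metric.ball t₀ ε) :=
      (convex_Icc a b).inter (convex_ball t₀ ε)
    -- `ρ(γ)` and `A` solve the same equation, so the terms `-ρ(γ)⁻¹ B A` and `ρ(γ)⁻¹ B A` cancel.
    have hder : ∀ t ∈ Icc a b ∩ Metric.ball t₀ ε,
        HasDerivWithinAt (fun τ => Ring.inverse (ρ (γ τ) : Matrix (Fin k) (Fin k) ℝ) * A τ) 0
          (Icc a b ∩ Metric.ball t₀ ε) t := by
      rintro t ⟨ht, htb⟩
      have hBt : B' t = B t := by simp only [B', projIcc_of_mem hab ht]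
      have h1 := (hball t htb).hasDerivWithinAt (s := Icc a b ∩ Metric.ball t₀ ε)
      have h2 := h1.ringInverse (ρ (γ t)).isUnit
      have h3 := h2.mul ((hA t ht).mono inter_subset_left)
      refine h3.congr_deriv ?_
      rw [hBt, Ring.inverse_unit]
      simp only [mul_assoc, Units.mul_inv, mul_one, neg_mul]
      rw [neg_add_cancel]
    rw [Filter.eventually_iff_exists_mem]
    refine ⟨Icc a b ∩ Metric.ball t₀ ε,
      Filter.inter_mem self_mem_nhdsWithin (mem_nhdsWithin_of_mem_nhds (Metric.ball_mem_nhds _ hε)),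
      fun t ht => ⟨γ t, ?_⟩⟩
    have h1 := hconv.norm_image_sub_le_of_norm_hasDerivWithin_le (C := 0) hder (by simp)
      ⟨ht₀, Metric.mem_ball_self hε⟩ ht
    rw [zero_mul] at h1
    have h2 := sub_eq_zero.mp (norm_le_zero_iff.mp h1)
    rw [hγ0, map_one, Units.val_one, Ring.inverse_one, one_mul, Ring.inverse_unit] at h2
    rw [← h2, ← mul_assoc, Units.mul_inv, one_mul]
  · rintro x y z - - - ⟨g, hg⟩ ⟨g', hg'⟩
    exact ⟨g' * g, by rw [hg', hg, map_mul, Units.val_mul, mul_assoc]⟩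
  · rintro x y - - ⟨g, hg⟩
    exact ⟨g⁻¹, by rw [hg, map_inv, ← mul_assoc, Units.inv_mul, one_mul]⟩

/-- The Lie algebra is stable under the adjoint action of the group. -/
lemma rep_conj_mem_range_diffRep [T2Space G] [SecondCountableTopology G]
    (hρ : IsSmoothRep (EG := EG) ρ) (hinj : Function.Injective ρ) (c : G)
    {Y : Matrix (Fin k) (Fin k) ℝ} (hY : Y ∈ LinearMap.range (diffRep (EG := EG) ρ)) :
    (ρ c : Matrix (Fin k) (Fin k) ℝ) * Y * Ring.inverse (ρ c : Matrix (Fin k) (Fin k) ℝ) ∈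
      LinearMap.range (diffRep (EG := EG) ρ) := by
  obtain ⟨γ, hγ0, hγ⟩ := exists_hasDerivAt_rep hρ hinj (B := fun _ => Y) continuous_const
    (fun _ => hY) 0
  obtain ⟨ε, hε, hball⟩ := Metric.eventually_nhds_iff_ball.mp hγ
  have hsub : Icc 0 (ε / 2) ⊆ Metric.ball (0 : ℝ) ε := by
    intro t ht
    rw [Metric.mem_ball, Real.dist_eq, sub_zero, abs_of_nonneg ht.1]
    linarith [ht.2]
  have hA : ∀ t ∈ Metric.ball (0 : ℝ) ε, HasDerivAt
      (fun t => (ρ c : Matrix (Fin k) (Fin k) ℝ) * ρ (γ t) *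
        Ring.inverse (ρ c : Matrix (Fin k) (Fin k) ℝ))
      ((ρ c : Matrix (Fin k) (Fin k) ℝ) * (Y * ρ (γ t)) *
        Ring.inverse (ρ c : Matrix (Fin k) (Fin k) ℝ)) t := fun t ht =>
    ((hball t ht).const_mul _).mul_const _
  -- The curve `c γ(t) c⁻¹` stays in the group and has initial velocity `c Y c⁻¹` after applying
  -- `ρ`.
  refine mem_range_diffRep_of_curve hρ hinj (half_pos hε)
    (fun t ht => (hA t (hsub ht)).continuousAt.continuousWithinAt)
    (fun t ht => hA t (hsub (Ioo_subset_Icc_self ht))) ?_ ?_ ?_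
  · have h1 : ContinuousAt (fun t => (ρ (γ t) : Matrix (Fin k) (Fin k) ℝ)) 0 :=
      (hball 0 (Metric.mem_ball_self hε)).continuousAt
    have h2 : ContinuousAt (fun t => (ρ c : Matrix (Fin k) (Fin k) ℝ) * (Y * ρ (γ t)) *
        Ring.inverse (ρ c : Matrix (Fin k) (Fin k) ℝ)) 0 :=
      (continuousAt_const.mul (continuousAt_const.mul h1)).mul continuousAt_const
    have h3 := h2.tendsto
    rw [hγ0, map_one, Units.val_one, mul_one] at h3
    exact h3.mono_left nhdsWithin_le_nhds
  · rw [hγ0, map_one, Units.val_one, mul_one, Ring.inverse_unit, Units.mul_inv]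
  · intro t _
    refine ⟨c * γ t * c⁻¹, ?_⟩
    rw [Ring.inverse_unit, map_mul, map_mul, map_inv]
    rfl

/-- The Lie algebra of the image of a representation is stable under the commutator. -/
lemma commutator_mem_range_diffRep [T2Space G] [SecondCountableTopology G]
    (hρ : IsSmoothRep (EG := EG) ρ) (hinj : Function.Injective ρ)
    {X Y : Matrix (Fin k) (Fin k) ℝ} (hX : X ∈ LinearMap.range (diffRep (EG := EG) ρ))
    (hY : Y ∈ LinearMap.range (diffRep (EG := EG) ρ)) :
    X * Y - Y * X ∈ LinearMap.range (diffRep (EG := EG) ρ) := by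
  obtain ⟨γ, hγ0, hγ⟩ := exists_hasDerivAt_rep hρ hinj (B := fun _ => X) continuous_const
    (fun _ => hX) 0
  have h0 := hγ.self_of_nhds
  have h1 : HasDerivAt (fun t => (ρ (γ t) : Matrix (Fin k) (Fin k) ℝ) * Y *
      Ring.inverse (ρ (γ t) : Matrix (Fin k) (Fin k) ℝ)) (X * Y - Y * X) 0 := by
    have h2 := h0.hasDerivWithinAt (s := univ) |>.ringInverse (ρ (γ 0)).isUnit
    rw [hasDerivWithinAt_univ] at h2
    refine ((h0.mul_const Y).mul h2).congr_deriv ?_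
    rw [hγ0, map_one, Units.val_one, Ring.inverse_one]
    simp [sub_eq_add_neg]
  have hclosed : IsClosed (LinearMap.range (diffRep (EG := EG) ρ) :
      Set (Matrix (Fin k) (Fin k) ℝ)) := Submodule.closed_of_finiteDimensional _
  have h3 := hasDerivAt_iff_tendsto_slope.mp h1
  -- The commutator is the limit of difference quotients of the adjoint orbit of `Y`, all of which
  -- lie in the closed subspace.
  refine hclosed.mem_of_tendsto h3 (Filter.Eventually.of_forall fun t => ?_)
  rw [slope, vsub_eq_sub]
  exact Submodule.smul_mem _ _ (Submodule.sub_mem _ (rep_conj_mem_range_diffRep hρ hinj _ hY)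
    (rep_conj_mem_range_diffRep hρ hinj _ hY))

end LieAlgebraOfRepresentation

/-! ### Smoothness of coefficients in a local frame -/

section LocalFrames

variable {E : Type*} [NormedAddCommGroup E] [NormedSpace ℝ E]
  {M : Type*} [TopologicalSpace M] [ChartedSpace E M] {k : ℕ}
  {V : M → Type*} [TopologicalSpace (TotalSpace (Fin k → ℝ) V)]
  [∀ x, AddCommGroup (V x)] [∀ x, Module ℝ (V x)] [∀ x, TopologicalSpace (V x)]
  [FiberBundle (Fin k → ℝ) V]

/-- The values at `y` of the sections `s j`, read in a trivialization, as a linear map. -/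
def frameMap (e : Trivialization (Fin k → ℝ) (π (Fin k → ℝ) V)) (s : Fin k → (x : M) → V x)
    (y : M) : (Fin k → ℝ) →L[ℝ] (Fin k → ℝ) :=
  ∑ j, (ContinuousLinearMap.proj j : (Fin k → ℝ) →L[ℝ] ℝ).smulRight (e ⟨y, s j y⟩).2

lemma IsLocalFrameOn.sum_coeff_smul {s : Fin k → (x : M) → V x} {U : Set M}
    (hs : IsLocalFrameOn 𝓘(ℝ, E) (Fin k → ℝ) ∞ s U) {y : M} (hy : y ∈ U) (v : V y) :
    ∑ j, hs.coeff j y v • s j y = v := by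
  have h1 := (hs.toBasisAt hy).sum_repr v
  simpa [IsLocalFrameOn.coeff, hy] using h1

lemma IsLocalFrameOn.coeff_frame {s : Fin k → (x : M) → V x} {U : Set M}
    (hs : IsLocalFrameOn 𝓘(ℝ, E) (Fin k → ℝ) ∞ s U) {y : M} (hy : y ∈ U) (i j : Fin k) :
    hs.coeff i y (s j y) = if i = j then 1 else 0 := by
  simp only [IsLocalFrameOn.coeff, hy, dite_true, Module.Basis.coord_apply]
  rw [← hs.toBasisAt_coe hy j, Module.Basis.repr_self, Finsupp.single_apply]
  simp only [eq_comm]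

lemma IsLocalFrameOn.ext_coeff {s : Fin k → (x : M) → V x} {U : Set M}
    (hs : IsLocalFrameOn 𝓘(ℝ, E) (Fin k → ℝ) ∞ s U) {y : M} (hy : y ∈ U) {v w : V y}
    (h : ∀ j, hs.coeff j y v = hs.coeff j y w) : v = w := by
  rw [← hs.sum_coeff_smul hy v, ← hs.sum_coeff_smul hy w]
  simp_rw [h]

omit [∀ x, TopologicalSpace (V x)] [FiberBundle (Fin k → ℝ) V] in
lemma frameMap_apply (e : Trivialization (Fin k → ℝ) (π (Fin k → ℝ) V)) [e.IsLinear ℝ]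
    (s : Fin k → (x : M) → V x) {y : M} (hy : y ∈ e.baseSet) (a : Fin k → ℝ) :
    frameMap e s y a = (e ⟨y, ∑ j, a j • s j y⟩).2 := by
  have h : ∀ v, (e ⟨y, v⟩).2 = e.linearEquivAt ℝ y hy v := fun v => rfl
  simp only [frameMap, h, map_sum, map_smul]
  simp

/-- A frame is a basis of each fibre, so its matrix in a trivialization is invertible and
coefficients come from inverting it. Smoothness of coefficients thus reduces to smoothness of
inversion. -/
lemma IsLocalFrameOn.exists_equiv_frameMap {s : Fin k → (x : M) → V x} {U : Set M}
    (hs : IsLocalFrameOn 𝓘(ℝ, E) (Fin k → ℝ) ∞ s U)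
    (e : Trivialization (Fin k → ℝ) (π (Fin k → ℝ) V)) [e.IsLinear ℝ] {y : M} (hyU : y ∈ U)
    (hy : y ∈ e.baseSet) :
    ∃ L : (Fin k → ℝ) ≃L[ℝ] (Fin k → ℝ), (L : (Fin k → ℝ) →L[ℝ] (Fin k → ℝ)) = frameMap e s y ∧
      ∀ (v : V y) (j : Fin k), hs.coeff j y v = L.symm (e ⟨y, v⟩).2 j := by
  let L₀ : (Fin k → ℝ) ≃ₗ[ℝ] (Fin k → ℝ) :=
    (hs.toBasisAt hyU).equivFun.symm.trans (e.linearEquivAt ℝ y hy)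
  have h1 : ∀ a, L₀ a = frameMap e s y a := by
    intro a
    rw [frameMap_apply e s hy]
    simp only [L₀, LinearEquiv.trans_apply, Module.Basis.equivFun_symm_apply,
      IsLocalFrameOn.toBasisAt_coe]
    rfl
  refine ⟨L₀.toContinuousLinearEquiv, ?_, ?_⟩
  · ext1 a
    exact h1 a
  · intro v j
    have h2 : L₀.symm (e ⟨y, v⟩).2 = (hs.toBasisAt hyU).equivFun v := by
      rw [LinearEquiv.symm_apply_eq]
      simp only [L₀, LinearEquiv.trans_apply, LinearEquiv.symm_apply_apply]
      rfl
    change _ = L₀.symm (e ⟨y, v⟩).2 j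
    rw [h2]
    simp [IsLocalFrameOn.coeff, hyU]

variable [VectorBundle ℝ (Fin k → ℝ) V]

/-- The coefficients of a `C^n` map into the bundle with respect to a smooth local frame are
`C^n`. -/
lemma IsLocalFrameOn.contMDiffWithinAt_coeff_comp {s : Fin k → (x : M) → V x} {U : Set M}
    (hs : IsLocalFrameOn 𝓘(ℝ, E) (Fin k → ℝ) ∞ s U) (hU : IsOpen U)
    {E' : Type*} [NormedAddCommGroup E'] [NormedSpace ℝ E'] {H' : Type*} [TopologicalSpace H']
    {I' : ModelWithCorners ℝ E' H'}
    {N : Type*} [TopologicalSpace N] [ChartedSpace H' N] {c : N → M} {η : (p : N) → V (c p)}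
    {S : Set N} {p₀ : N} {n : ℕ∞ω} (hn : n ≤ ∞) (hp₀ : c p₀ ∈ U)
    (hη : ContMDiffWithinAt I' (𝓘(ℝ, E).prod 𝓘(ℝ, Fin k → ℝ)) n
      (fun p => (⟨c p, η p⟩ : TotalSpace (Fin k → ℝ) V)) S p₀) (j : Fin k) :
    ContMDiffWithinAt I' 𝓘(ℝ, ℝ) n (fun p => hs.coeff j (c p) (η p)) S p₀ := by
  obtain ⟨hc, hη2⟩ := contMDiffWithinAt_totalSpace.mp hη
  set e := trivializationAt (Fin k → ℝ) V (c p₀) with he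
  have hp₀e : c p₀ ∈ e.baseSet := FiberBundle.mem_baseSet_trivializationAt' (c p₀)
  have hF : ContMDiffAt 𝓘(ℝ, E) 𝓘(ℝ, (Fin k → ℝ) →L[ℝ] (Fin k → ℝ)) ∞ (frameMap e s) (c p₀) := by
    unfold frameMap
    refine ContMDiffAt.sum fun i _ => ?_
    have h1 := (contMDiffAt_section (c p₀)).mp ((hs.contMDiffOn i).contMDiffAt (hU.mem_nhds hp₀))
    have h2 : ContDiff ℝ ∞ (fun w : Fin k → ℝ =>
        (ContinuousLinearMap.proj i : (Fin k → ℝ) →L[ℝ] ℝ).smulRight w) :=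
      contDiff_const.smulRight contDiff_id
    exact ContMDiffAt.comp (c p₀) h2.contDiffAt.contMDiffAt h1
  obtain ⟨L, hL, -⟩ := hs.exists_equiv_frameMap e hp₀ hp₀e
  have hinv : ContMDiffAt 𝓘(ℝ, E) 𝓘(ℝ, (Fin k → ℝ) →L[ℝ] (Fin k → ℝ)) ∞
      (fun y => ContinuousLinearMap.inverse (frameMap e s y)) (c p₀) := by
    have h1 := contDiffAt_map_inverse (𝕜 := ℝ) (n := ∞) L
    rw [hL] at h1
    exact ContMDiffAt.comp (c p₀) h1.contMDiffAt hF
  have h3 : ContMDiffWithinAt I' 𝓘(ℝ, Fin k → ℝ) n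
      (fun p => ContinuousLinearMap.inverse (frameMap e s (c p)) (e ⟨c p, η p⟩).2) S p₀ :=
    ContMDiffWithinAt.clm_apply ((hinv.of_le hn).comp_contMDiffWithinAt p₀ hc) hη2
  have h4 : ContMDiffWithinAt I' 𝓘(ℝ, ℝ) n
      (fun p => ContinuousLinearMap.inverse (frameMap e s (c p)) (e ⟨c p, η p⟩).2 j) S p₀ :=
    ContMDiffAt.comp_contMDiffWithinAt p₀
      (ContinuousLinearMap.proj j : (Fin k → ℝ) →L[ℝ] ℝ).contDiff.contDiffAt.contMDiffAt h3
  have hmem : ∀ y ∈ U ∩ e.baseSet, ∀ v : V y,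
      hs.coeff j y v = ContinuousLinearMap.inverse (frameMap e s y) (e ⟨y, v⟩).2 j := by
    rintro y ⟨hyU, hye⟩ v
    obtain ⟨L, hL, hL'⟩ := hs.exists_equiv_frameMap e hyU hye
    rw [hL', ← hL, ContinuousLinearMap.inverse_equiv]
    rfl
  refine h4.congr_of_eventuallyEq ?_ (hmem _ ⟨hp₀, hp₀e⟩ _)
  filter_upwards [hc.continuousWithinAt.eventually
    ((hU.inter e.open_baseSet).mem_nhds ⟨hp₀, hp₀e⟩)] with p hp using hmem _ hp _

lemma IsLocalFrameOn.contMDiffAt_coeff {s : Fin k → (x : M) → V x} {U : Set M}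
    (hs : IsLocalFrameOn 𝓘(ℝ, E) (Fin k → ℝ) ∞ s U) (hU : IsOpen U) {t : (x : M) → V x} {x : M}
    (hx : x ∈ U)
    (ht : ContMDiffAt 𝓘(ℝ, E) (𝓘(ℝ, E).prod 𝓘(ℝ, Fin k → ℝ)) ∞
      (fun y => (⟨y, t y⟩ : TotalSpace (Fin k → ℝ) V)) x) (j : Fin k) :
    ContMDiffAt 𝓘(ℝ, E) 𝓘(ℝ, ℝ) ∞ (fun y => hs.coeff j y (t y)) x :=
  hs.contMDiffWithinAt_coeff_comp hU le_rfl hx ht.contMDiffWithinAt j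

end LocalFrames

/-! ### Smooth connections acting on local sections -/

section CovariantDerivatives

variable {E : Type*} [NormedAddCommGroup E] [NormedSpace ℝ E] [FiniteDimensional ℝ E]
  {M : Type*} [TopologicalSpace M] [ChartedSpace E M] [IsManifold 𝓘(ℝ, E) ∞ M] [T2Space M] {k : ℕ}
  {V : M → Type*} [TopologicalSpace (TotalSpace (Fin k → ℝ) V)]
  [∀ x, AddCommGroup (V x)] [∀ x, Module ℝ (V x)] [∀ x, TopologicalSpace (V x)]
  [∀ x, IsTopologicalAddGroup (V x)] [∀ x, ContinuousSMul ℝ (V x)]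
  [FiberBundle (Fin k → ℝ) V] [VectorBundle ℝ (Fin k → ℝ) V]
  (cov : CovariantDerivative 𝓘(ℝ, E) (Fin k → ℝ) V)

/-- A smooth connection takes smooth local sections to smooth local sections. -/
lemma contMDiffAt_cov_of_contMDiffOn
    [CovariantDerivative.ContMDiffCovariantDerivative cov ∞] {t : (x : M) → V x} {U : Set M}
    (hU : IsOpen U) (ht : ContMDiffOn 𝓘(ℝ, E) (𝓘(ℝ, E).prod 𝓘(ℝ, Fin k → ℝ)) ∞
      (fun y => (⟨y, t y⟩ : TotalSpace (Fin k → ℝ) V)) U) {x : M} (hx : x ∈ U) :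
    ContMDiffAt 𝓘(ℝ, E) (𝓘(ℝ, E).prod 𝓘(ℝ, E →L[ℝ] (Fin k → ℝ))) ∞
      (fun y => (⟨y, cov t y⟩ : TotalSpace (E →L[ℝ] (Fin k → ℝ))
        fun y => TangentSpace 𝓘(ℝ, E) y →L[ℝ] V y)) x := by
  -- Smoothness of the connection is applied to a global section: cut `t` off by a bump function
  -- supported in `U`, then use locality of the connection where this function is `1`.
  obtain ⟨f, hf, -⟩ := (SmoothBumpFunction.nhds_basis_support (I := 𝓘(ℝ, E))
    (hU.mem_nhds hx)).mem_iff.mp (hU.mem_nhds hx)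
  have hft : ContMDiff 𝓘(ℝ, E) (𝓘(ℝ, E).prod 𝓘(ℝ, Fin k → ℝ)) ∞
      (fun y => (⟨y, ((f : M → ℝ) • t) y⟩ : TotalSpace (Fin k → ℝ) V)) :=
    ContMDiffOn.smul_section_of_tsupport f.contMDiff.contMDiffOn hU hf ht
  have hglob := (CovariantDerivative.ContMDiffCovariantDerivative.contMDiff (cov := cov)
    (k := ∞)).contMDiff (σ := (f : M → ℝ) • t) hft.contMDiffOn
  refine (hglob.contMDiffAt Filter.univ_mem).congr_of_eventuallyEq ?_
  -- Locality at a nearby point `y` requires `f = 1` on a neighbourhood of `y`, not only at `y`.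
  filter_upwards [f.eventuallyEq_one.eventually_nhds, hU.mem_nhds hx] with y hy hyU
  have h1 : cov t y = cov ((f : M → ℝ) • t) y := by
    refine cov.isCovariantDerivativeOnUniv.congr_of_eventuallyEq
      ((ht.contMDiffAt (hU.mem_nhds hyU)).mdifferentiableAt (by simp))
      (hft.contMDiffAt.mdifferentiableAt (by simp)) Filter.univ_mem ?_
    filter_upwards [hy] with z hz
    simp [hz]
  rw [h1]

end CovariantDerivatives

/-! ### Connection forms along curves and the equation of parallel sections -/

section ParallelSections

variable {E : Type*} [NormedAddCommGroup E] [NormedSpace ℝ E]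
  {M : Type*} [TopologicalSpace M] [ChartedSpace E M]

lemma hasMFDerivWithinAt_velocity {σ : ℝ → M}
    (hσ : ContMDiffOn 𝓘(ℝ, ℝ) 𝓘(ℝ, E) ∞ σ (Icc 0 1)) {t : ℝ} (ht : t ∈ Icc (0 : ℝ) 1) :
    HasMFDerivWithinAt 𝓘(ℝ, ℝ) 𝓘(ℝ, E) σ (Icc 0 1) t
      (mfderivWithin 𝓘(ℝ, ℝ) 𝓘(ℝ, E) σ (Icc 0 1) t) :=
  ((hσ t ht).mdifferentiableWithinAt (by simp)).hasMFDerivWithinAt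

/-- Chain rule for a function along a curve. -/
lemma hasDerivWithinAt_comp_curve {σ : ℝ → M}
    (hσ : ContMDiffOn 𝓘(ℝ, ℝ) 𝓘(ℝ, E) ∞ σ (Icc 0 1)) {t : ℝ} (ht : t ∈ Icc (0 : ℝ) 1)
    {f : M → ℝ} (hf : MDifferentiableAt 𝓘(ℝ, E) 𝓘(ℝ, ℝ) f (σ t)) :
    HasDerivWithinAt (fun τ => f (σ τ))
      (mvfderiv 𝓘(ℝ, E) f (σ t) (velocity (E := E) σ t)) (Icc 0 1) t := by
  let D : ℝ →L[ℝ] ℝ := (mfderiv 𝓘(ℝ, E) 𝓘(ℝ, ℝ) f (σ t)).comp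
    (mfderivWithin 𝓘(ℝ, ℝ) 𝓘(ℝ, E) σ (Icc 0 1) t)
  have h1 : HasMFDerivWithinAt 𝓘(ℝ, ℝ) 𝓘(ℝ, ℝ) (fun τ => f (σ τ)) (Icc 0 1) t D :=
    hf.hasMFDerivAt.comp_hasMFDerivWithinAt t (hasMFDerivWithinAt_velocity hσ ht)
  have h2 : HasFDerivWithinAt (fun τ => f (σ τ)) D (Icc 0 1) t :=
    hasMFDerivWithinAt_iff_hasFDerivWithinAt.mp h1
  exact h2.hasDerivWithinAt

variable [IsManifold 𝓘(ℝ, E) ∞ M]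

/-- The velocity is the tangent map of `σ` applied to the unit vector field on the line. Continuity
is all that the linear equations of parallel transport need. -/
lemma contMDiffWithinAt_velocity {σ : ℝ → M}
    (hσ : ContMDiffOn 𝓘(ℝ, ℝ) 𝓘(ℝ, E) ∞ σ (Icc 0 1)) {t : ℝ} (ht : t ∈ Icc (0 : ℝ) 1) :
    ContMDiffWithinAt 𝓘(ℝ, ℝ) 𝓘(ℝ, E).tangent 0
      (fun τ => (⟨σ τ, velocity σ τ⟩ : TangentBundle 𝓘(ℝ, E) M)) (Icc 0 1) t := by
  have h1 : ContMDiffOn 𝓘(ℝ, ℝ).tangent 𝓘(ℝ, E).tangent 0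
      (tangentMapWithin 𝓘(ℝ, ℝ) 𝓘(ℝ, E) σ (Icc 0 1)) _ :=
    hσ.contMDiffOn_tangentMapWithin (m := 0) (by simp)
      ((uniqueDiffOn_Icc zero_lt_one).uniqueMDiffOn)
  have h2 : ContMDiff 𝓘(ℝ, ℝ) 𝓘(ℝ, ℝ).tangent 0
      (fun τ : ℝ => (⟨τ, (1 : ℝ)⟩ : TangentBundle 𝓘(ℝ, ℝ) ℝ)) :=
    contMDiff_vectorSpace_iff_contDiff.mpr contDiff_const
  exact ContMDiffWithinAt.comp t (h1 ⟨t, (1 : ℝ)⟩ ht) h2.contMDiffAt.contMDiffWithinAt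
    fun τ hτ => hτ

variable [FiniteDimensional ℝ E] [T2Space M] {k : ℕ}
  {V : M → Type*} [TopologicalSpace (TotalSpace (Fin k → ℝ) V)]
  [∀ x, AddCommGroup (V x)] [∀ x, Module ℝ (V x)] [∀ x, TopologicalSpace (V x)]
  [∀ x, IsTopologicalAddGroup (V x)] [∀ x, ContinuousSMul ℝ (V x)]
  [FiberBundle (Fin k → ℝ) V] [VectorBundle ℝ (Fin k → ℝ) V]
  {cov : CovariantDerivative 𝓘(ℝ, E) (Fin k → ℝ) V}

/-- The entries of the connection form are continuous along smooth curves. -/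
lemma continuousWithinAt_connectionForm_velocity
    [ContMDiffVectorBundle ∞ (Fin k → ℝ) V 𝓘(ℝ, E)]
    [CovariantDerivative.ContMDiffCovariantDerivative cov ∞]
    {s : Fin k → (x : M) → V x} {U : Set M} (hs : IsLocalFrameOn 𝓘(ℝ, E) (Fin k → ℝ) ∞ s U)
    (hU : IsOpen U) {σ : ℝ → M} (hσ : ContMDiffOn 𝓘(ℝ, ℝ) 𝓘(ℝ, E) ∞ σ (Icc 0 1)) {t : ℝ}
    (ht : t ∈ Icc (0 : ℝ) 1) (htU : σ t ∈ U) (j i : Fin k) :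
    ContinuousWithinAt (fun τ => connectionForm cov hs (σ τ) (velocity σ τ) j i) (Icc 0 1) t := by
  have h1 := (contMDiffAt_cov_of_contMDiffOn cov hU (hs.contMDiffOn i) htU).of_le
    (m := 0) (by simp)
  have h2 := h1.comp_contMDiffWithinAt t ((hσ t ht).of_le (m := 0) (by simp))
  have h3 : ContMDiffWithinAt 𝓘(ℝ, ℝ) (𝓘(ℝ, E).prod 𝓘(ℝ, Fin k → ℝ)) 0
      (fun τ => (⟨σ τ, cov (s i) (σ τ) (velocity σ τ)⟩ : TotalSpace (Fin k → ℝ) V))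
      (Icc 0 1) t :=
    ContMDiffWithinAt.clm_bundle_apply h2 (contMDiffWithinAt_velocity hσ ht)
  exact (hs.contMDiffWithinAt_coeff_comp hU (n := 0) (by simp) htU h3 j).continuousWithinAt

omit [IsManifold 𝓘(ℝ, E) ∞ M] [FiniteDimensional ℝ E] [T2Space M] in
/-- The Leibniz rule for linear combinations of sections. -/
lemma cov_sum_smul (cov : CovariantDerivative 𝓘(ℝ, E) (Fin k → ℝ) V)
    {s : Fin k → (x : M) → V x} {f : Fin k → M → ℝ} {x : M}
    (hs : ∀ i, MDifferentiableAt 𝓘(ℝ, E) (𝓘(ℝ, E).prod 𝓘(ℝ, Fin k → ℝ))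
      (fun y => (⟨y, s i y⟩ : TotalSpace (Fin k → ℝ) V)) x)
    (hf : ∀ i, MDifferentiableAt 𝓘(ℝ, E) 𝓘(ℝ, ℝ) (f i) x) (v : TangentSpace 𝓘(ℝ, E) x) :
    cov (fun y => ∑ i, f i y • s i y) x v =
      ∑ i, (f i x • cov (s i) x v + mvfderiv 𝓘(ℝ, E) (f i) x v • s i x) := by
  have key : ∀ S : Finset (Fin k), cov (fun y => ∑ i ∈ S, f i y • s i y) x v =
      ∑ i ∈ S, (f i x • cov (s i) x v + mvfderiv 𝓘(ℝ, E) (f i) x v • s i x) := by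
    intro S
    induction S using Finset.induction_on with
    | empty =>
      have h0 : (fun y => ∑ i ∈ (∅ : Finset (Fin k)), f i y • s i y) = (0 : (x : M) → V x) := by
        ext y
        simp
      rw [h0, cov.isCovariantDerivativeOnUniv.zero]
      simp
    | insert a S ha ih =>
      have h0 : (fun y => ∑ i ∈ insert a S, f i y • s i y) =
          f a • s a + fun y => ∑ i ∈ S, f i y • s i y := by
        ext y
        simp [Finset.sum_insert ha]
      have hS : MDifferentiableAt 𝓘(ℝ, E) (𝓘(ℝ, E).prod 𝓘(ℝ, Fin k → ℝ))
          (fun y => (⟨y, ∑ i ∈ S, f i y • s i y⟩ : TotalSpace (Fin k → ℝ) V)) x :=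
        MDifferentiableAt.sum_section fun i _ => (hf i).smul_section (hs i)
      rw [h0, cov.isCovariantDerivativeOnUniv.add ((hf a).smul_section (hs a)) hS,
        Finset.sum_insert ha, add_apply, ih,
        cov.isCovariantDerivativeOnUniv.leibniz (hs a) (hf a)]
      rfl
  exact key Finset.univ

omit [IsManifold 𝓘(ℝ, E) ∞ M] [FiniteDimensional ℝ E] [T2Space M] in
/-- The covariant derivative in a local frame. -/
lemma coeff_cov {s : Fin k → (x : M) → V x} {U : Set M}
    (hs : IsLocalFrameOn 𝓘(ℝ, E) (Fin k → ℝ) ∞ s U) (hU : IsOpen U) {x : M} (hx : x ∈ U)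
    {t : (x : M) → V x} (ht : ContMDiffAt 𝓘(ℝ, E) (𝓘(ℝ, E).prod 𝓘(ℝ, Fin k → ℝ)) ∞
      (fun y => (⟨y, t y⟩ : TotalSpace (Fin k → ℝ) V)) x)
    (v : TangentSpace 𝓘(ℝ, E) x) (j : Fin k) :
    hs.coeff j x (cov t x v) = ∑ i, connectionForm cov hs x v j i * hs.coeff i x (t x) +
      mvfderiv 𝓘(ℝ, E) (fun y => hs.coeff j y (t y)) x v := by
  have hsm : ∀ i, MDifferentiableAt 𝓘(ℝ, E) (𝓘(ℝ, E).prod 𝓘(ℝ, Fin k → ℝ))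
      (fun y => (⟨y, s i y⟩ : TotalSpace (Fin k → ℝ) V)) x := fun i =>
    ((hs.contMDiffOn i).contMDiffAt (hU.mem_nhds hx)).mdifferentiableAt (by simp)
  have hfm : ∀ i, MDifferentiableAt 𝓘(ℝ, E) 𝓘(ℝ, ℝ) (fun y => hs.coeff i y (t y)) x := fun i =>
    (hs.contMDiffAt_coeff hU hx ht i).mdifferentiableAt (by simp)
  -- The expansion of `t` in the frame holds only on `U`; locality of the connection makes this
  -- sufficient.
  have h1 : cov t x = cov (fun y => ∑ i, hs.coeff i y (t y) • s i y) x := by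
    refine cov.isCovariantDerivativeOnUniv.congr_of_eventuallyEq
      (ht.mdifferentiableAt (by simp))
      (MDifferentiableAt.sum_section fun i _ => (hfm i).smul_section (hsm i)) Filter.univ_mem ?_
    filter_upwards [hU.mem_nhds hx] with y hy using (hs.sum_coeff_smul hy (t y)).symm
  rw [h1, cov_sum_smul cov hsm hfm]
  simp only [map_sum, map_add, map_smul, smul_eq_mul, hs.coeff_frame hx, mul_ite, mul_one,
    mul_zero, Finset.sum_add_distrib, Finset.sum_ite_eq, Finset.mem_univ, if_true]
  congr 1
  exact Finset.sum_congr rfl fun i _ => mul_comm _ _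

/-- The section `ξ` along `σ` is parallel on the set of times `J`. -/
def IsParallelOn (cov : CovariantDerivative 𝓘(ℝ, E) (Fin k → ℝ) V) (σ : ℝ → M)
    (ξ : (t : ℝ) → V (σ t)) (J : Set ℝ) : Prop :=
  ∀ (U : Set M) (s : Fin k → (x : M) → V x)
    (hs : IsLocalFrameOn 𝓘(ℝ, E) (Fin k → ℝ) ∞ s U), IsOpen U →
    ∀ t ∈ Icc (0 : ℝ) 1, σ t ∈ U → ∀ j,
      HasDerivWithinAt (fun τ => hs.coeff j (σ τ) (ξ τ))
        (-∑ i, connectionForm cov hs (σ t) (velocity σ t) j i * hs.coeff i (σ t) (ξ t)) J t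

omit [IsManifold 𝓘(ℝ, E) ∞ M] [FiniteDimensional ℝ E] [T2Space M] in
/-- The equation of parallel sections is independent of the frame. -/
lemma hasDerivWithinAt_coeff_change_frame {s s' : Fin k → (x : M) → V x} {U U' : Set M}
    (hs : IsLocalFrameOn 𝓘(ℝ, E) (Fin k → ℝ) ∞ s U)
    (hs' : IsLocalFrameOn 𝓘(ℝ, E) (Fin k → ℝ) ∞ s' U') (hU : IsOpen U) (hU' : IsOpen U')
    {σ : ℝ → M} (hσ : ContMDiffOn 𝓘(ℝ, ℝ) 𝓘(ℝ, E) ∞ σ (Icc 0 1)) {ξ : (t : ℝ) → V (σ t)}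
    {J : Set ℝ} (hJ : J ⊆ Icc 0 1) {t : ℝ} (ht : t ∈ Icc (0 : ℝ) 1) (htU : σ t ∈ U)
    (htU' : σ t ∈ U')
    (h : ∀ j, HasDerivWithinAt (fun τ => hs.coeff j (σ τ) (ξ τ))
        (-∑ i, connectionForm cov hs (σ t) (velocity σ t) j i * hs.coeff i (σ t) (ξ t)) J t)
    (j : Fin k) :
    HasDerivWithinAt (fun τ => hs'.coeff j (σ τ) (ξ τ))
        (-∑ i, connectionForm cov hs' (σ t) (velocity σ t) j i * hs'.coeff i (σ t) (ξ t)) J t := by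
  have hchange : ∀ y ∈ U, ∀ (v : V y) (m : Fin k),
      hs'.coeff m y v = ∑ i, hs'.coeff m y (s i y) * hs.coeff i y v := by
    intro y hy v m
    conv_lhs => rw [← hs.sum_coeff_smul hy v]
    simp only [map_sum, map_smul, smul_eq_mul, mul_comm]
  have hsm : ∀ i, ContMDiffAt 𝓘(ℝ, E) (𝓘(ℝ, E).prod 𝓘(ℝ, Fin k → ℝ)) ∞
      (fun y => (⟨y, s i y⟩ : TotalSpace (Fin k → ℝ) V)) (σ t) := fun i =>
    (hs.contMDiffOn i).contMDiffAt (hU.mem_nhds htU)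
  -- With `a` the matrix of `s` in `s'`, this is the transformation law `a' = a ω - ω' a` along the
  -- curve.
  have hd : ∀ i, HasDerivWithinAt (fun τ => hs'.coeff j (σ τ) (s i (σ τ)))
      (hs'.coeff j (σ t) (cov (s i) (σ t) (velocity σ t)) -
        ∑ m, connectionForm cov hs' (σ t) (velocity σ t) j m * hs'.coeff m (σ t) (s i (σ t)))
      J t := by
    intro i
    have h1 := hasDerivWithinAt_comp_curve hσ ht
      ((hs'.contMDiffAt_coeff hU' htU' (hsm i) j).mdifferentiableAt (by simp))
    rw [coeff_cov hs' hU' htU' (hsm i), add_sub_cancel_left]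
    exact h1.mono hJ
  have hsum := HasDerivWithinAt.fun_sum (u := Finset.univ) fun i _ => (hd i).fun_mul (h i)
  have hev : (fun τ => hs'.coeff j (σ τ) (ξ τ)) =ᶠ[𝓝[J] t]
      fun τ => ∑ i, hs'.coeff j (σ τ) (s i (σ τ)) * hs.coeff i (σ τ) (ξ τ) := by
    filter_upwards [((hσ t ht).continuousWithinAt.mono hJ).eventually (hU.mem_nhds htU)] with τ hτ
      using hchange _ hτ _ _
  refine (hsum.congr_of_eventuallyEq hev (hchange _ htU _ _)).congr_deriv ?_
  have hcf : ∀ i, hs'.coeff j (σ t) (cov (s i) (σ t) (velocity σ t)) =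
      ∑ l, hs'.coeff j (σ t) (s l (σ t)) * connectionForm cov hs (σ t) (velocity σ t) l i :=
    fun i => hchange _ htU _ _
  have hξ : ∀ m, hs'.coeff m (σ t) (ξ t) =
      ∑ i, hs'.coeff m (σ t) (s i (σ t)) * hs.coeff i (σ t) (ξ t) := fun m => hchange _ htU _ _
  -- For the coefficient vector `f` of `ξ` in `s`, `(a f)' = (a ω - ω' a) f - a ω f = -ω' (a f)`.
  simp only [hcf, hξ, sub_mul, Finset.sum_mul, Finset.mul_sum, Finset.sum_add_distrib,
    Finset.sum_sub_distrib, mul_neg, Finset.sum_neg_distrib, mul_assoc]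
  rw [Finset.sum_comm, sub_eq_add_neg, add_assoc, add_comm, add_assoc, neg_add_cancel, add_zero,
    Finset.sum_comm]

end ParallelSections

/-! ### Existence and uniqueness of parallel sections -/

section ParallelExistence

/-- Linear differential equations have solutions on short intervals, whatever the initial value. -/
lemma exists_hasDerivWithinAt_linear {F : Type*} [NormedAddCommGroup F] [NormedSpace ℝ F]
    [CompleteSpace F] {W : ℝ → F →L[ℝ] F} {a b K : ℝ} (hab : a ≤ b)
    (hW : ContinuousOn W (Icc a b)) (hK : ∀ t ∈ Icc a b, ‖W t‖ ≤ K) (hKab : K * (b - a) ≤ 1 / 2)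
    (x₀ : F) :
    ∃ f : ℝ → F, f a = x₀ ∧ ∀ t ∈ Icc a b, HasDerivWithinAt f (W t (f t)) (Icc a b) t := by
  have hK0 : 0 ≤ K := (norm_nonneg _).trans (hK a ⟨le_rfl, hab⟩)
  lift K to NNReal using hK0
  -- In the ball of radius `‖x₀‖ + 1` around `x₀` the speed is at most `K (2 ‖x₀‖ + 1)`. Since `K (b
  -- - a) ≤ 1/2`, the solution moves by at most `‖x₀‖ + 1/2`; the admissible length does not depend
  -- on `x₀`.
  have hPL : IsPicardLindelof (fun t x => W t x) (tmin := a) (tmax := b) ⟨a, le_rfl, hab⟩ x₀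
      (‖x₀‖₊ + 1) 0 (K * (2 * ‖x₀‖₊ + 1)) K := by
    constructor
    · intro t ht
      refine LipschitzOnWith.of_dist_le_mul fun x _ y _ => ?_
      rw [dist_eq_norm, dist_eq_norm, ← map_sub]
      exact (W t).le_of_opNorm_le (hK t ht) _
    · intro x _
      exact hW.clm_apply continuousOn_const
    · intro t ht x hx
      have h1 : ‖x‖ ≤ 2 * ‖x₀‖ + 1 := by
        have h2 : ‖x - x₀‖ ≤ ‖x₀‖ + 1 := by simpa [dist_eq_norm] using hx
        calc ‖x‖ = ‖x₀ + (x - x₀)‖ := by simp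
          _ ≤ ‖x₀‖ + ‖x - x₀‖ := norm_add_le _ _
          _ ≤ _ := by linarith
      refine ((W t).le_of_opNorm_le (hK t ht) x).trans ?_
      push_cast
      gcongr
    · have h1 : max (b - a) (a - a) = b - a := by simp [hab]
      simp only [h1]
      push_cast
      have h2 : (K : ℝ) * (2 * ‖x₀‖ + 1) * (b - a) = (K * (b - a)) * (2 * ‖x₀‖ + 1) := by ring
      rw [h2]
      calc K * (b - a) * (2 * ‖x₀‖ + 1) ≤ 1 / 2 * (2 * ‖x₀‖ + 1) := by gcongr
        _ ≤ ‖x₀‖ + 1 - 0 := by linarith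
  obtain ⟨f, hf0, hf⟩ := hPL.exists_eq_forall_mem_Icc_hasDerivWithinAt₀
  exact ⟨f, hf0, hf⟩

/-- The continuous linear endomorphism of `ℝᵏ` given by the matrix `-A`. -/
def negMulVecCLM {k : ℕ} (A : Matrix (Fin k) (Fin k) ℝ) : (Fin k → ℝ) →L[ℝ] (Fin k → ℝ) :=
  ∑ j, ∑ i, (-A j i) •
    (ContinuousLinearMap.proj i : (Fin k → ℝ) →L[ℝ] ℝ).smulRight (Pi.single j 1)

lemma negMulVecCLM_apply {k : ℕ} (A : Matrix (Fin k) (Fin k) ℝ) (a : Fin k → ℝ) (j : Fin k) :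
    negMulVecCLM A a j = -∑ i, A j i * a i := by
  simp [negMulVecCLM, Finset.sum_apply, Pi.single_apply, Finset.sum_ite_eq]

lemma continuousWithinAt_negMulVecCLM {k : ℕ} {A : ℝ → Matrix (Fin k) (Fin k) ℝ} {S : Set ℝ}
    {t : ℝ} (hA : ∀ j i, ContinuousWithinAt (fun τ => A τ j i) S t) :
    ContinuousWithinAt (fun τ => negMulVecCLM (A τ)) S t := by
  unfold negMulVecCLM
  exact tendsto_finsetSum _ fun j _ => tendsto_finsetSum _ fun i _ =>
    ((hA j i).neg.smul continuousWithinAt_const)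

variable {E : Type*} [NormedAddCommGroup E] [NormedSpace ℝ E] [FiniteDimensional ℝ E]
  {M : Type*} [TopologicalSpace M] [ChartedSpace E M] [IsManifold 𝓘(ℝ, E) ∞ M] [T2Space M]
  {k : ℕ} {V : M → Type*} [TopologicalSpace (TotalSpace (Fin k → ℝ) V)]
  [∀ x, AddCommGroup (V x)] [∀ x, Module ℝ (V x)] [∀ x, TopologicalSpace (V x)]
  [∀ x, IsTopologicalAddGroup (V x)] [∀ x, ContinuousSMul ℝ (V x)]
  [FiberBundle (Fin k → ℝ) V] [VectorBundle ℝ (Fin k → ℝ) V]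
  {cov : CovariantDerivative 𝓘(ℝ, E) (Fin k → ℝ) V}

omit [FiniteDimensional ℝ E] [IsManifold 𝓘(ℝ, E) ∞ M] [T2Space M]
  [VectorBundle ℝ (Fin k → ℝ) V] in
/-- Two parallel sections which agree at the common end point can be glued. -/
lemma IsParallelOn.glue {σ : ℝ → M} {ξ η : (t : ℝ) → V (σ t)} {a b c : ℝ} (hab : a ≤ b)
    (hbc : b ≤ c) (hξ : IsParallelOn cov σ ξ (Icc a b)) (hη : IsParallelOn cov σ η (Icc b c))
    (h : ξ b = η b) :
    IsParallelOn cov σ (fun t => if t ≤ b then ξ t else η t) (Icc a c) := by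
  intro U s hs hU t ht htU j
  have h1 : ∀ τ ∈ Icc a b, (if τ ≤ b then ξ τ else η τ) = ξ τ := fun τ hτ => if_pos hτ.2
  have h2 : ∀ τ ∈ Icc b c, (if τ ≤ b then ξ τ else η τ) = η τ := by
    intro τ hτ
    rcases hτ.1.eq_or_lt with rfl | hlt
    · rw [if_pos le_rfl, h]
    · rw [if_neg hlt.not_ge]
  rw [← Icc_union_Icc_eq_Icc hab hbc]
  refine HasDerivWithinAt.union ?_ ?_
  · by_cases htm : t ∈ Icc a b
    · simp only [h1 t htm]
      exact (hξ U s hs hU t ht htU j).congr (fun τ hτ => by simp only [h1 τ hτ])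
        (by simp only [h1 t htm])
    -- Away from the closure of the set, a derivative within it is a vacuous condition.
    · exact HasFDerivWithinAt.of_notMem_closure (by rwa [isClosed_Icc.closure_eq])
  · by_cases htm : t ∈ Icc b c
    · simp only [h2 t htm]
      exact (hη U s hs hU t ht htU j).congr (fun τ hτ => by simp only [h2 τ hτ])
        (by simp only [h2 t htm])
    · exact HasFDerivWithinAt.of_notMem_closure (by rwa [isClosed_Icc.closure_eq])

variable [ContMDiffVectorBundle ∞ (Fin k → ℝ) V 𝓘(ℝ, E)]
  [CovariantDerivative.ContMDiffCovariantDerivative cov ∞]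

/-- Local existence of parallel sections along a smooth curve. -/
lemma exists_isParallelOn_of_near {σ : ℝ → M}
    (hσ : ContMDiffOn 𝓘(ℝ, ℝ) 𝓘(ℝ, E) ∞ σ (Icc 0 1)) {t₀ : ℝ} (ht₀ : t₀ ∈ Icc (0 : ℝ) 1) :
    ∃ δ > 0, ∀ a ∈ Icc (0 : ℝ) 1, ∀ b ∈ Icc (0 : ℝ) 1, a ≤ b → a ∈ Metric.ball t₀ δ →
      b ∈ Metric.ball t₀ δ → ∀ v : V (σ a), ∃ ξ : (t : ℝ) → V (σ t),
        IsParallelOn cov σ ξ (Icc a b) ∧ ξ a = v := by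
  set e := trivializationAt (Fin k → ℝ) V (σ t₀) with he
  set U := e.baseSet with hUdef
  have hU : IsOpen U := e.open_baseSet
  have ht₀U : σ t₀ ∈ U := FiberBundle.mem_baseSet_trivializationAt' (σ t₀)
  set s := e.localFrame (Pi.basisFun ℝ (Fin k)) with hsdef
  have hs : IsLocalFrameOn 𝓘(ℝ, E) (Fin k → ℝ) ∞ s U :=
    e.isLocalFrameOn_localFrame_baseSet 𝓘(ℝ, E) ∞ (Pi.basisFun ℝ (Fin k))
  let W : ℝ → (Fin k → ℝ) →L[ℝ] (Fin k → ℝ) := fun τ =>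
    negMulVecCLM (connectionForm cov hs (σ τ) (velocity σ τ))
  have hW : ∀ t ∈ Icc (0 : ℝ) 1, σ t ∈ U → ContinuousWithinAt W (Icc 0 1) t := fun t ht htU =>
    continuousWithinAt_negMulVecCLM fun j i =>
      continuousWithinAt_connectionForm_velocity hs hU hσ ht htU j i
  have hev : ∀ᶠ τ in 𝓝[Icc 0 1] t₀, σ τ ∈ U ∧ ‖W τ‖ ≤ ‖W t₀‖ + 1 :=
    ((hσ t₀ ht₀).continuousWithinAt.eventually (hU.mem_nhds ht₀U)).and
      ((hW t₀ ht₀ ht₀U).norm.eventually (Iic_mem_nhds (lt_add_one _)))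
  obtain ⟨δ₁, hδ₁, hball⟩ := Metric.mem_nhdsWithin_iff.mp hev
  set K : ℝ := ‖W t₀‖ + 1 with hK
  have hK0 : 0 < K := by positivity
  -- Two times in the ball differ by at most `1 / (2 K)`, whence `K (b - a) ≤ 1/2`. The radius
  -- depends neither on the starting time nor on the initial vector, which makes gluing by
  -- compactness possible.
  refine ⟨min δ₁ (1 / (4 * K)), by positivity, fun a ha b hb hab had hbd v => ?_⟩
  have hsub : ∀ τ ∈ Icc a b, τ ∈ Icc (0 : ℝ) 1 ∧ σ τ ∈ U ∧ ‖W τ‖ ≤ K := by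
    intro τ hτ
    have h1 : τ ∈ Icc (0 : ℝ) 1 := ⟨ha.1.trans hτ.1, hτ.2.trans hb.2⟩
    have h2 : τ ∈ Metric.ball t₀ δ₁ :=
      Metric.ball_subset_ball (min_le_left _ _)
        (Real.ball_eq_Ioo t₀ _ ▸ (ordConnected_Ioo.out (Real.ball_eq_Ioo t₀ _ ▸ had)
          (Real.ball_eq_Ioo t₀ _ ▸ hbd) hτ))
    exact ⟨h1, hball ⟨h2, h1⟩⟩
  have hKab : K * (b - a) ≤ 1 / 2 := by
    rw [Metric.mem_ball, Real.dist_eq] at had hbd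
    have h1 := (abs_lt.mp (had.trans_le (min_le_right _ _))).1
    have h2 := (abs_lt.mp (hbd.trans_le (min_le_right _ _))).2
    have h3 : b - a ≤ 2 * (1 / (4 * K)) := by linarith
    calc K * (b - a) ≤ K * (2 * (1 / (4 * K))) := by gcongr
      _ = 1 / 2 := by field_simp; norm_num
  have hJ : Icc a b ⊆ Icc 0 1 := fun τ hτ => (hsub τ hτ).1
  obtain ⟨f, hf0, hf⟩ := exists_hasDerivWithinAt_linear hab
    (fun τ hτ => (hW τ (hsub τ hτ).1 (hsub τ hτ).2.1).mono hJ) (fun τ hτ => (hsub τ hτ).2.2) hKab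
    (fun j => hs.coeff j (σ a) v)
  have hcoeff : ∀ τ ∈ Icc a b, ∀ j, hs.coeff j (σ τ) (∑ i, f τ i • s i (σ τ)) = f τ j := by
    intro τ hτ j
    simp only [map_sum, map_smul, smul_eq_mul, hs.coeff_frame (hsub τ hτ).2.1, mul_ite, mul_one,
      mul_zero, Finset.sum_ite_eq, Finset.mem_univ, if_true]
  refine ⟨fun τ => ∑ i, f τ i • s i (σ τ), ?_, ?_⟩
  · intro U' s' hs' hU' t ht htU' j
    by_cases htm : t ∈ Icc a b
    · refine hasDerivWithinAt_coeff_change_frame hs hs' hU hU' hσ hJ ht (hsub t htm).2.1 htU'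
        (fun j => ?_) j
      have h1 := hasDerivWithinAt_pi.mp (hf t htm) j
      rw [negMulVecCLM_apply] at h1
      simp only [hcoeff t htm]
      exact h1.congr (fun τ hτ => hcoeff τ hτ j) (hcoeff t htm j)
    · exact HasFDerivWithinAt.of_notMem_closure (by rwa [isClosed_Icc.closure_eq])
  · refine hs.ext_coeff (hsub a ⟨le_rfl, hab⟩).2.1 fun j => ?_
    rw [hcoeff a ⟨le_rfl, hab⟩, hf0]

/-- Existence of parallel sections along a smooth curve. -/
lemma exists_isParallelAlong {σ : ℝ → M}
    (hσ : ContMDiffOn 𝓘(ℝ, ℝ) 𝓘(ℝ, E) ∞ σ (Icc 0 1)) (v : V (σ 0)) :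
    ∃ ξ : (t : ℝ) → V (σ t), IsParallelAlong cov σ ξ ∧ ξ 0 = v := by
  choose δ hδ hloc using fun t : Icc (0 : ℝ) 1 => exists_isParallelOn_of_near (cov := cov) hσ t.2
  -- A monotone subdivision of `[0, 1]`, eventually equal to `1`, each step of which lies in one
  -- ball of local solvability; the local sections are glued step by step.
  obtain ⟨t, ht0, hmono, ⟨m, hm⟩, hcov⟩ := exists_monotone_Icc_subset_open_cover_Icc
    (zero_le_one' ℝ) (c := fun t₀ : Icc (0 : ℝ) 1 => {t | (t : ℝ) ∈ Metric.ball (t₀ : ℝ) (δ t₀)})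
    (fun t₀ => Metric.isOpen_ball.preimage continuous_subtype_val)
    (fun t₀ _ => mem_iUnion.mpr ⟨t₀, Metric.mem_ball_self (hδ t₀)⟩)
  have key : ∀ n, ∃ ξ : (t : ℝ) → V (σ t), IsParallelOn cov σ ξ (Icc 0 (t n)) ∧ ξ 0 = v := by
    intro n
    induction n with
    | zero =>
      obtain ⟨i, hi⟩ := hcov 0
      have h0 : ((t 0 : Icc (0 : ℝ) 1) : ℝ) = 0 := ht0
      have h00 := hi ⟨le_rfl, hmono (Nat.zero_le 1)⟩
      have h000 : (0 : ℝ) ∈ Metric.ball (i : ℝ) (δ i) := by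
        have h1 : ((t 0 : Icc (0 : ℝ) 1) : ℝ) ∈ Metric.ball (i : ℝ) (δ i) := h00
        rwa [h0] at h1
      obtain ⟨ξ, hξ, hξ0⟩ := hloc i 0 (by simp) 0 (by simp) le_rfl h000 h000 v
      rw [h0]
      exact ⟨ξ, hξ, hξ0⟩
    | succ n ih =>
      obtain ⟨ξ, hξ, hξ0⟩ := ih
      obtain ⟨i, hi⟩ := hcov n
      have hle : t n ≤ t (n + 1) := hmono n.le_succ
      obtain ⟨η, hη, hη0⟩ := hloc i (t n) (t n).2 (t (n + 1)) (t (n + 1)).2 hle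
        (hi ⟨le_rfl, hle⟩) (hi ⟨hle, le_rfl⟩) (ξ (t n))
      refine ⟨_, hξ.glue (t n).2.1 hle hη hη0.symm, ?_⟩
      simp only [(t n).2.1, if_true, hξ0]
  obtain ⟨ξ, hξ, hξ0⟩ := key m
  have h1 : ((t m : Icc (0 : ℝ) 1) : ℝ) = 1 := by rw [hm m le_rfl]
  rw [h1] at hξ
  exact ⟨ξ, hξ, hξ0⟩

/-- Existence excludes the default value `0`. The section obtained is the one chosen in the
definition; identifying it with another one takes uniqueness. -/
lemma parallelTransport_spec {σ : ℝ → M}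
    (hσ : ContMDiffOn 𝓘(ℝ, ℝ) 𝓘(ℝ, E) ∞ σ (Icc 0 1)) (v : V (σ 0)) :
    ∃ ξ : (t : ℝ) → V (σ t), IsParallelAlong cov σ ξ ∧ ξ 0 = v ∧
      parallelTransport cov σ v = ξ 1 := by
  have h := exists_isParallelAlong (cov := cov) hσ v
  refine ⟨h.choose, h.choose_spec.1, h.choose_spec.2, ?_⟩
  rw [parallelTransport, dif_pos h]

/-- Uniqueness of parallel sections along a curve in the domain of a local frame. -/
lemma IsParallelAlong.eq_of_eq_zero {s : Fin k → (x : M) → V x} {U : Set M}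
    (hs : IsLocalFrameOn 𝓘(ℝ, E) (Fin k → ℝ) ∞ s U) (hU : IsOpen U) {σ : ℝ → M}
    (hσ : ContMDiffOn 𝓘(ℝ, ℝ) 𝓘(ℝ, E) ∞ σ (Icc 0 1)) (hσU : ∀ t ∈ Icc (0 : ℝ) 1, σ t ∈ U)
    {ξ η : (t : ℝ) → V (σ t)} (hξ : IsParallelAlong cov σ ξ) (hη : IsParallelAlong cov σ η)
    (h0 : ξ 0 = η 0) {t : ℝ} (ht : t ∈ Icc (0 : ℝ) 1) : ξ t = η t := by
  let W : ℝ → (Fin k → ℝ) →L[ℝ] (Fin k → ℝ) := fun τ =>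
    negMulVecCLM (connectionForm cov hs (σ τ) (velocity σ τ))
  have hW : ContinuousOn W (Icc 0 1) := fun t ht =>
    continuousWithinAt_negMulVecCLM fun j i =>
      continuousWithinAt_connectionForm_velocity hs hU hσ ht (hσU t ht) j i
  obtain ⟨K, hK⟩ := isCompact_Icc.exists_bound_of_continuousOn hW
  have hder : ∀ {ζ : (t : ℝ) → V (σ t)}, IsParallelAlong cov σ ζ → ∀ t ∈ Icc (0 : ℝ) 1,
      HasDerivWithinAt (fun τ j => hs.coeff j (σ τ) (ζ τ))
        (W t fun j => hs.coeff j (σ t) (ζ t)) (Icc 0 1) t := by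
    intro ζ hζ t ht
    refine hasDerivWithinAt_pi.mpr fun j => ?_
    rw [negMulVecCLM_apply]
    exact hζ U s hs hU t ht (hσU t ht) j
  have huniq := ODE_solution_unique_of_mem_Icc_right (v := fun t x => W t x) (s := fun _ => univ)
    (K := K.toNNReal) (a := 0) (b := 1)
    (fun t ht => LipschitzOnWith.of_dist_le_mul fun x _ y _ => by
      rw [dist_eq_norm, dist_eq_norm, ← map_sub]
      exact (W t).le_of_opNorm_le
        ((hK t (Ico_subset_Icc_self ht)).trans (Real.le_coe_toNNReal K)) _)
    (fun t ht => (hder hξ t ht).continuousWithinAt)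
    (fun t ht => (hder hξ t (Ico_subset_Icc_self ht)).mono_of_mem_nhdsWithin
      (Icc_mem_nhdsGE_of_mem ht)) (fun _ _ => mem_univ _)
    (fun t ht => (hder hη t ht).continuousWithinAt)
    (fun t ht => (hder hη t (Ico_subset_Icc_self ht)).mono_of_mem_nhdsWithin
      (Icc_mem_nhdsGE_of_mem ht)) (fun _ _ => mem_univ _) (by simp only [h0]) ht
  exact hs.ext_coeff (hσU t ht) fun j => congrFun huniq j

end ParallelExistence

/-! ### Admissible bases and frames -/

section AdmissibleFrames

variable {E : Type*} [NormedAddCommGroup E] [NormedSpace ℝ E]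
  {M : Type*} [TopologicalSpace M] [ChartedSpace E M] {k : ℕ}
  {V : M → Type*} [TopologicalSpace (TotalSpace (Fin k → ℝ) V)]
  [∀ x, AddCommGroup (V x)] [∀ x, Module ℝ (V x)] [∀ x, TopologicalSpace (V x)]
  [FiberBundle (Fin k → ℝ) V] {G : Type*} [Group G] {ρ : G →* GL (Fin k) ℝ}
  (𝒜 : GBundleStructure E V ρ)

namespace GBundleStructure

/-- Admissibility of a basis can be tested in any gauge. -/
lemma isAdmissibleBasis_iff_gauge {e : Trivialization (Fin k → ℝ) (π (Fin k → ℝ) V)}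
    (he : e ∈ 𝒜.gauges) {y : M} (hy : y ∈ e.baseSet) {b : Fin k → V y} :
    𝒜.IsAdmissibleBasis y b ↔ ∃ g : G, ∀ j,
      (e ⟨y, b j⟩).2 = (ρ g : Matrix (Fin k) (Fin k) ℝ) *ᵥ Pi.single j 1 := by
  constructor
  · rintro ⟨e', he', hy', g, hg⟩
    obtain ⟨g', hg'⟩ := 𝒜.transition e' he' e he y ⟨hy', hy⟩
    refine ⟨g' * g, fun j => ?_⟩
    rw [hg j, hg', map_mul, Units.val_mul, Matrix.mulVec_mulVec]
  · rintro ⟨g, hg⟩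
    refine ⟨e, he, hy, g, fun j => ?_⟩
    rw [← hg j, e.symm_apply_apply_mk hy]

/-- The matrix relating two bases, one of which is admissible, is in the group if and only if the
other one is admissible. -/
lemma isAdmissibleBasis_iff_of_eq_sum {y : M} {s b : Fin k → V y} {C : Matrix (Fin k) (Fin k) ℝ}
    (hs : 𝒜.IsAdmissibleBasis y s) (hb : ∀ j, b j = ∑ i, C i j • s i) :
    𝒜.IsAdmissibleBasis y b ↔ ∃ g : G, C = ρ g := by
  obtain ⟨e, he, hy⟩ := 𝒜.cover y
  obtain ⟨g₀, hg₀⟩ := (𝒜.isAdmissibleBasis_iff_gauge he hy).mp hs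
  have := 𝒜.linear e he
  have hlin : ∀ v, (e ⟨y, v⟩).2 = e.linearEquivAt ℝ y hy v := fun v => rfl
  have hb' : ∀ j, (e ⟨y, b j⟩).2 =
      ((ρ g₀ : Matrix (Fin k) (Fin k) ℝ) * C) *ᵥ Pi.single j 1 := by
    intro j
    rw [hlin, hb j, map_sum, ← Matrix.mulVec_mulVec]
    have h1 : C *ᵥ Pi.single j 1 = ∑ i, C i j • (Pi.single i 1 : Fin k → ℝ) := by
      ext i
      simp [Finset.sum_apply, Pi.single_apply]
    rw [h1, Matrix.mulVec_sum]
    refine Finset.sum_congr rfl fun i _ => ?_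
    rw [map_smul, ← hlin, hg₀ i, Matrix.mulVec_smul]
  rw [𝒜.isAdmissibleBasis_iff_gauge he hy]
  simp only [hb']
  constructor
  · rintro ⟨g, hg⟩
    have h1 : (ρ g₀ : Matrix (Fin k) (Fin k) ℝ) * C = ρ g := by
      ext i j
      have h2 := congrFun (hg j) i
      simpa only [Matrix.mulVec_single_one, Matrix.col_apply] using h2
    refine ⟨g₀⁻¹ * g, ?_⟩
    rw [map_mul, Units.val_mul, ← h1, ← mul_assoc, map_inv, Units.inv_mul, one_mul]
  · rintro ⟨g, rfl⟩
    exact ⟨g₀ * g, fun j => by rw [map_mul, Units.val_mul]⟩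

/-- This turns admissibility of transported bases into a condition on the coefficient matrix along
the curve. -/
lemma IsAdmissibleFrameOn.isAdmissibleBasis_iff {𝒜 : GBundleStructure E V ρ}
    {s : Fin k → (x : M) → V x} {U : Set M} (hs : 𝒜.IsAdmissibleFrameOn s U) {y : M} (hy : y ∈ U)
    {b : Fin k → V y} :
    𝒜.IsAdmissibleBasis y b ↔
      ∃ g : G, (Matrix.of fun i j => hs.isLocalFrameOn.coeff i y (b j)) = ρ g :=
  𝒜.isAdmissibleBasis_iff_of_eq_sum (hs.isAdmissibleBasis y hy) fun j =>
    (hs.isLocalFrameOn.sum_coeff_smul hy (b j)).symm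

/-- The frame given by a gauge is admissible. -/
lemma isAdmissibleFrameOn_gauge {e : Trivialization (Fin k → ℝ) (π (Fin k → ℝ) V)}
    (he : e ∈ 𝒜.gauges) :
    𝒜.IsAdmissibleFrameOn (fun j y => e.symm y (Pi.single j 1)) e.baseSet := by
  have := 𝒜.linear e he
  have hsymm : ∀ y (hy : y ∈ e.baseSet) j, e.symm y (Pi.single j 1) =
      ((Pi.basisFun ℝ (Fin k)).map (e.linearEquivAt ℝ y hy).symm) j := by
    intro y hy j
    simp
  refine ⟨e.open_baseSet, ⟨?_, ?_, ?_⟩, ?_⟩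
  · intro y hy
    simp only [hsymm y hy]
    exact Module.Basis.linearIndependent _
  · intro y hy
    simp only [hsymm y hy]
    exact (Module.Basis.span_eq _).ge
  · intro j
    have h1 : ContMDiffOn 𝓘(ℝ, E) (𝓘(ℝ, E).prod 𝓘(ℝ, Fin k → ℝ)) ∞
        (fun y : M => (y, (Pi.single j 1 : Fin k → ℝ))) e.baseSet :=
      contMDiffOn_id.prodMk contMDiffOn_const
    have h2 := (𝒜.smooth_symm e he).comp h1 fun y hy => e.mem_target.mpr hy
    refine h2.congr fun y hy => ?_
    exact e.mk_symm hy _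
  · intro y hy
    refine ⟨e, he, hy, 1, fun j => ?_⟩
    rw [map_one, Units.val_one, Matrix.one_mulVec]

end GBundleStructure

end AdmissibleFrames

/-! ### Admissible connections and connection forms -/

section AdmissibleConnections

attribute [local instance] Matrix.linftyOpNormedRing Matrix.linftyOpNormedAlgebra

lemma hasDerivWithinAt_matrix {k : ℕ} {A : ℝ → Matrix (Fin k) (Fin k) ℝ}
    {A' : Matrix (Fin k) (Fin k) ℝ} {S : Set ℝ} {t : ℝ}
    (h : ∀ i j, HasDerivWithinAt (fun τ => A τ i j) (A' i j) S t) : HasDerivWithinAt A A' S t := by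
  have h1 : ∀ B : Matrix (Fin k) (Fin k) ℝ, B = ∑ i, ∑ j, B i j • Matrix.single i j (1 : ℝ) := by
    intro B
    conv_lhs => rw [Matrix.matrix_eq_sum_single B]
    simp [Matrix.smul_single]
  have h2 : HasDerivWithinAt (fun τ => ∑ i, ∑ j, A τ i j • Matrix.single i j (1 : ℝ))
      (∑ i, ∑ j, A' i j • Matrix.single i j (1 : ℝ)) S t :=
    HasDerivWithinAt.fun_sum fun i _ => HasDerivWithinAt.fun_sum fun j _ => (h i j).smul_const _
  rw [← h1 A'] at h2
  exact h2.congr (fun τ _ => h1 (A τ)) (h1 (A t))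

lemma continuousWithinAt_matrix {k : ℕ} {A : ℝ → Matrix (Fin k) (Fin k) ℝ} {S : Set ℝ} {t : ℝ}
    (h : ∀ i j, ContinuousWithinAt (fun τ => A τ i j) S t) : ContinuousWithinAt A S t :=
  tendsto_pi_nhds.mpr fun i => tendsto_pi_nhds.mpr fun j => h i j

section Curves

variable {E : Type*} [NormedAddCommGroup E] [NormedSpace ℝ E]
  {M : Type*} [TopologicalSpace M] [ChartedSpace E M]

lemma mul_mem_Icc_zero_one {τ t : ℝ} (hτ : τ ∈ Icc (0 : ℝ) 1) (ht : t ∈ Icc (0 : ℝ) 1) :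
    τ * t ∈ Icc (0 : ℝ) 1 :=
  ⟨mul_nonneg hτ.1 ht.1, mul_le_one₀ hτ.2 ht.1 ht.2⟩

/-- Admissibility speaks only of transport from time `0` to time `1`; the rescaled curve `t ↦ σ (τ
t)` extracts from it what happens at time `τ`. -/
lemma contMDiffOn_comp_mul {σ : ℝ → M} (hσ : ContMDiffOn 𝓘(ℝ, ℝ) 𝓘(ℝ, E) ∞ σ (Icc 0 1))
    {τ : ℝ} (hτ : τ ∈ Icc (0 : ℝ) 1) :
    ContMDiffOn 𝓘(ℝ, ℝ) 𝓘(ℝ, E) ∞ (fun t => σ (τ * t)) (Icc 0 1) :=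
  hσ.comp (contDiff_const.mul contDiff_id).contMDiff.contMDiffOn fun _ ht =>
    mul_mem_Icc_zero_one hτ ht

lemma velocity_comp_mul {σ : ℝ → M} (hσ : ContMDiffOn 𝓘(ℝ, ℝ) 𝓘(ℝ, E) ∞ σ (Icc 0 1))
    {τ t : ℝ} (hτ : τ ∈ Icc (0 : ℝ) 1) (ht : t ∈ Icc (0 : ℝ) 1) :
    velocity (E := E) (fun t => σ (τ * t)) t = τ • velocity (E := E) σ (τ * t) := by
  have h1 : HasMFDerivWithinAt 𝓘(ℝ, ℝ) 𝓘(ℝ, ℝ) (fun t => τ * t) (Icc 0 1) t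
      (τ • ContinuousLinearMap.id ℝ ℝ) := by
    have h0 : HasFDerivWithinAt (fun t => τ * t) (τ • ContinuousLinearMap.id ℝ ℝ) (Icc 0 1) t :=
      ((hasFDerivAt_id t).const_mul τ).hasFDerivWithinAt
    exact hasMFDerivWithinAt_iff_hasFDerivWithinAt.mpr h0
  have h2 := (hasMFDerivWithinAt_velocity hσ (mul_mem_Icc_zero_one hτ ht)).comp t h1
    fun s hs => mul_mem_Icc_zero_one hτ hs
  have h3 := h2.mfderivWithin ((uniqueDiffOn_Icc zero_lt_one).uniqueMDiffOn t ht)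
  have h4 := congrArg (fun L : ℝ →L[ℝ] E => L 1) h3
  refine h4.trans ?_
  let L : ℝ →L[ℝ] E := mfderivWithin 𝓘(ℝ, ℝ) 𝓘(ℝ, E) σ (Icc 0 1) (τ * t)
  change L (τ • (1 : ℝ)) = τ • L 1
  exact map_smul L τ 1

/-- Through each tangent vector in an open set goes, up to scaling, a smooth curve in this set. -/
lemma exists_curve_velocity [IsManifold 𝓘(ℝ, E) ∞ M] {U : Set M} (hU : IsOpen U) {x : M}
    (hx : x ∈ U) (v : TangentSpace 𝓘(ℝ, E) x) :
    ∃ σ : ℝ → M, ContMDiffOn 𝓘(ℝ, ℝ) 𝓘(ℝ, E) ∞ σ (Icc 0 1) ∧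
      (∀ t ∈ Icc (0 : ℝ) 1, σ t ∈ U) ∧ ∃ c : ℝ, c ≠ 0 ∧
        (⟨σ 0, velocity σ 0⟩ : TangentBundle 𝓘(ℝ, E) M) = ⟨x, c • v⟩ := by
  set φ := extChartAt 𝓘(ℝ, E) x with hφ
  let w : E := v
  have hO : φ.target ∩ φ.symm ⁻¹' U ∈ 𝓝 (φ x) :=
    Filter.inter_mem (extChartAt_target_mem_nhds x)
      ((continuousAt_extChartAt_symm x).preimage_mem_nhds
        (by rw [extChartAt_to_inv]; exact hU.mem_nhds hx))
  have hlim : Filter.Tendsto (fun r : ℝ => φ x + r • w) (𝓝 0) (𝓝 (φ x)) := by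
    have h1 : Continuous fun r : ℝ => φ x + r • w := by fun_prop
    simpa using h1.tendsto 0
  obtain ⟨ε, hε, hball⟩ := Metric.eventually_nhds_iff_ball.mp (hlim.eventually hO)
  -- Slowing the straight line down by `c` keeps it in the chart and in `U` during the whole
  -- interval `[0, 1]`.
  set c : ℝ := ε / 2 with hc
  have hc0 : 0 < c := half_pos hε
  let ℓ : ℝ → E := fun t => φ x + (t * c) • w
  have hℓ : ∀ t ∈ Icc (0 : ℝ) 1, ℓ t ∈ φ.target ∩ φ.symm ⁻¹' U := by
    intro t ht
    refine hball (t * c) ?_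
    rw [Metric.mem_ball, Real.dist_eq, sub_zero, abs_of_nonneg (mul_nonneg ht.1 hc0.le)]
    calc t * c ≤ 1 * c := by gcongr; exact ht.2
      _ < ε := by rw [hc]; linarith
  have hℓs : ContDiff ℝ ∞ ℓ := contDiff_const.add ((contDiff_id.mul contDiff_const).smul
    contDiff_const)
  have hσ : ContMDiffOn 𝓘(ℝ, ℝ) 𝓘(ℝ, E) ∞ (fun t => φ.symm (ℓ t)) (Icc 0 1) :=
    (contMDiffOn_extChartAt_symm x).comp hℓs.contMDiff.contMDiffOn fun t ht => (hℓ t ht).1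
  refine ⟨fun t => φ.symm (ℓ t), hσ, fun t ht => (hℓ t ht).2, c, hc0.ne', ?_⟩
  have hℓ0 : ℓ 0 = φ x := by simp [ℓ]
  have hσ0 : φ.symm (ℓ 0) = x := by rw [hℓ0]; exact extChartAt_to_inv x
  have hid : HasMFDerivAt 𝓘(ℝ, E) 𝓘(ℝ, E) φ.symm (φ x)
      (ContinuousLinearMap.id ℝ E : E →L[ℝ] E) := by
    have h1 := (mdifferentiableWithinAt_extChartAt_symm (I := 𝓘(ℝ, E))
      (mem_extChartAt_target x)).hasMFDerivWithinAt
    rw [mfderivWithin_range_extChartAt_symm, modelWithCornersSelf_coe, Set.range_id] at h1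
    exact hasMFDerivWithinAt_univ.mp h1
  have hid' : HasMFDerivAt 𝓘(ℝ, E) 𝓘(ℝ, E) φ.symm (ℓ 0)
      (ContinuousLinearMap.id ℝ E : E →L[ℝ] E) := by
    rw [hℓ0]
    exact hid
  have hℓd : HasMFDerivWithinAt 𝓘(ℝ, ℝ) 𝓘(ℝ, E) ℓ (Icc 0 1) 0
      (ContinuousLinearMap.toSpanSingleton ℝ (c • w)) := by
    have h1 : HasDerivAt ℓ (c • w) 0 := by
      have h2 := (((hasDerivAt_id (0 : ℝ)).mul_const c).smul_const w).const_add (φ x)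
      exact h2.congr_deriv (by rw [one_mul])
    exact hasMFDerivWithinAt_iff_hasFDerivWithinAt.mpr h1.hasFDerivAt.hasFDerivWithinAt
  have h3 := (hid'.comp_hasMFDerivWithinAt 0 hℓd).mfderivWithin
    ((uniqueDiffOn_Icc zero_lt_one).uniqueMDiffOn 0 (by simp))
  have h4 : (velocity (E := E) (fun t => φ.symm (ℓ t)) 0 : E) = c • w := by
    have h5 := congrArg (fun L : ℝ →L[ℝ] E => L 1) h3
    refine h5.trans ?_
    change ContinuousLinearMap.toSpanSingleton ℝ (c • w) (1 : ℝ) = c • w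
    simp
  -- `σ 0 = x` is not definitional, so the two vectors lie in different fibres and are compared in
  -- the tangent bundle.
  have h6 : ∀ (p : M) (u : E), p = x → u = c • w →
      (⟨p, u⟩ : TangentBundle 𝓘(ℝ, E) M) = ⟨x, c • v⟩ := by
    rintro p u rfl rfl
    rfl
  exact h6 _ _ hσ0 h4

end Curves

variable {EG : Type*} [NormedAddCommGroup EG] [NormedSpace ℝ EG] [FiniteDimensional ℝ EG]
  {G : Type*} [TopologicalSpace G] [ChartedSpace EG G] [Group G] [LieGroup 𝓘(ℝ, EG) ∞ G]
  {k : ℕ} {ρ : G →* GL (Fin k) ℝ}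
  {E : Type*} [NormedAddCommGroup E] [NormedSpace ℝ E] [FiniteDimensional ℝ E]
  {M : Type*} [TopologicalSpace M] [ChartedSpace E M] [IsManifold 𝓘(ℝ, E) ∞ M] [T2Space M]
  {V : M → Type*} [TopologicalSpace (TotalSpace (Fin k → ℝ) V)]
  [∀ x, AddCommGroup (V x)] [∀ x, Module ℝ (V x)] [∀ x, TopologicalSpace (V x)]
  [∀ x, IsTopologicalAddGroup (V x)] [∀ x, ContinuousSMul ℝ (V x)]
  [FiberBundle (Fin k → ℝ) V] [VectorBundle ℝ (Fin k → ℝ) V]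
  [ContMDiffVectorBundle ∞ (Fin k → ℝ) V 𝓘(ℝ, E)]
  {𝒜 : GBundleStructure E V ρ}
  {cov : CovariantDerivative 𝓘(ℝ, E) (Fin k → ℝ) V}

omit [FiniteDimensional ℝ E] [IsManifold 𝓘(ℝ, E) ∞ M] [T2Space M]
  [VectorBundle ℝ (Fin k → ℝ) V] [ContMDiffVectorBundle ∞ (Fin k → ℝ) V 𝓘(ℝ, E)] in
lemma connectionForm_smul {s : Fin k → (x : M) → V x} {U : Set M}
    (hs : IsLocalFrameOn 𝓘(ℝ, E) (Fin k → ℝ) ∞ s U) (x : M) (c : ℝ)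
    (v : TangentSpace 𝓘(ℝ, E) x) :
    connectionForm cov hs x (c • v) = c • connectionForm cov hs x v := by
  ext i j
  simp [connectionForm]

omit [FiniteDimensional ℝ E] [IsManifold 𝓘(ℝ, E) ∞ M] [T2Space M]
  [VectorBundle ℝ (Fin k → ℝ) V] [ContMDiffVectorBundle ∞ (Fin k → ℝ) V 𝓘(ℝ, E)] in
/-- Parallel sections are compatible with the affine reparametrization of the initial part of a
curve. -/
lemma IsParallelAlong.comp_mul {σ : ℝ → M} (hσ : ContMDiffOn 𝓘(ℝ, ℝ) 𝓘(ℝ, E) ∞ σ (Icc 0 1))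
    {ξ : (t : ℝ) → V (σ t)} (hξ : IsParallelAlong cov σ ξ) {τ : ℝ} (hτ : τ ∈ Icc (0 : ℝ) 1) :
    IsParallelAlong cov (fun t => σ (τ * t)) fun t => ξ (τ * t) := by
  intro U s hs hU t ht htU j
  have h1 := hξ U s hs hU (τ * t) (mul_mem_Icc_zero_one hτ ht) htU j
  have h2 : HasDerivWithinAt (fun t : ℝ => τ * t) τ (Icc 0 1) t := by
    simpa using ((hasDerivAt_id t).const_mul τ).hasDerivWithinAt
  refine (h1.comp t h2 fun s hs => mul_mem_Icc_zero_one hτ hs).congr_deriv ?_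
  rw [velocity_comp_mul hσ hτ ht, connectionForm_smul]
  simp only [Matrix.smul_apply, smul_eq_mul, mul_assoc, ← Finset.mul_sum]
  ring

omit [FiniteDimensional ℝ E] [IsManifold 𝓘(ℝ, E) ∞ M] [T2Space M]
  [VectorBundle ℝ (Fin k → ℝ) V] [ContMDiffVectorBundle ∞ (Fin k → ℝ) V 𝓘(ℝ, E)] in
/-- The coefficient matrix of a family of parallel sections satisfies a linear equation. -/
lemma hasDerivWithinAt_coeff_matrix {s : Fin k → (x : M) → V x} {U : Set M}
    (hs : IsLocalFrameOn 𝓘(ℝ, E) (Fin k → ℝ) ∞ s U) (hU : IsOpen U) {σ : ℝ → M}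
    {ξ : Fin k → (t : ℝ) → V (σ t)} (hξ : ∀ j, IsParallelAlong cov σ (ξ j)) {t : ℝ}
    (ht : t ∈ Icc (0 : ℝ) 1) (htU : σ t ∈ U) :
    HasDerivWithinAt (fun τ => Matrix.of fun i j => hs.coeff i (σ τ) (ξ j τ))
      (-connectionForm cov hs (σ t) (velocity σ t) *
        Matrix.of fun i j => hs.coeff i (σ t) (ξ j t)) (Icc 0 1) t := by
  refine hasDerivWithinAt_matrix fun i j => ?_
  refine (hξ j U s hs hU t ht htU i).congr_deriv ?_
  rw [Matrix.neg_mul, Matrix.neg_apply, Matrix.mul_apply]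
  rfl

variable [CovariantDerivative.ContMDiffCovariantDerivative cov ∞]

/-- If the connection form takes its values in the Lie algebra, then parallel sections which form
an admissible basis at one time do so at all times. -/
lemma isAdmissibleBasis_of_isParallelAlong (hρ : IsSmoothRep (EG := EG) ρ)
    (hinj : Function.Injective ρ)
    (hform : ∀ (U : Set M) (s : Fin k → (x : M) → V x) (hs : 𝒜.IsAdmissibleFrameOn s U),
        ∀ x ∈ U, ∀ v : TangentSpace 𝓘(ℝ, E) x,
          ∃ h : GroupLieAlgebra 𝓘(ℝ, EG) G,
            connectionForm cov hs.isLocalFrameOn x v = diffRep ρ h)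
    {σ : ℝ → M} (hσ : ContMDiffOn 𝓘(ℝ, ℝ) 𝓘(ℝ, E) ∞ σ (Icc 0 1))
    {ξ : Fin k → (t : ℝ) → V (σ t)} (hξ : ∀ j, IsParallelAlong cov σ (ξ j)) {t t' : ℝ}
    (ht : t ∈ Icc (0 : ℝ) 1) (ht' : t' ∈ Icc (0 : ℝ) 1)
    (hadm : 𝒜.IsAdmissibleBasis (σ t) fun j => ξ j t) :
    𝒜.IsAdmissibleBasis (σ t') fun j => ξ j t' := by
  refine isPreconnected_Icc.induction₂' (fun t t' => (𝒜.IsAdmissibleBasis (σ t) fun j => ξ j t) →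
    𝒜.IsAdmissibleBasis (σ t') fun j => ξ j t') ?_ (fun x y z _ _ _ h1 h2 h => h2 (h1 h)) ht ht' hadm
  intro t₀ ht₀
  obtain ⟨e, he, het₀⟩ := 𝒜.cover (σ t₀)
  have hs := 𝒜.isAdmissibleFrameOn_gauge he
  obtain ⟨ε, hε, hball⟩ := Metric.mem_nhdsWithin_iff.mp
    ((hσ t₀ ht₀).continuousWithinAt.eventually (hs.isOpen.mem_nhds het₀))
  have hJ : Icc (max 0 (t₀ - ε / 2)) (min 1 (t₀ + ε / 2)) =
      Icc 0 1 ∩ Metric.closedBall t₀ (ε / 2) := by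
    rw [Real.closedBall_eq_Icc, Icc_inter_Icc]
  have hsub : ∀ τ ∈ Icc (max 0 (t₀ - ε / 2)) (min 1 (t₀ + ε / 2)),
      τ ∈ Icc (0 : ℝ) 1 ∧ σ τ ∈ e.baseSet := by
    intro τ hτ
    rw [hJ] at hτ
    exact ⟨hτ.1, hball ⟨Metric.closedBall_subset_ball (half_lt_self hε) hτ.2, hτ.1⟩⟩
  have hJ01 : Icc (max 0 (t₀ - ε / 2)) (min 1 (t₀ + ε / 2)) ⊆ Icc 0 1 := fun τ hτ => (hsub τ hτ).1
  -- In the gauge frame the coefficient matrix solves a linear equation with coefficient `-ω(σ')` in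
  -- the Lie algebra, hence moves within one coset.
  have hkey := fun {τ τ' : ℝ} => exists_eq_rep_mul_of_hasDerivWithinAt (EG := EG)
    (A := fun τ => Matrix.of fun i j => hs.isLocalFrameOn.coeff i (σ τ) (ξ j τ))
    (B := fun τ => -connectionForm cov hs.isLocalFrameOn (σ τ) (velocity σ τ)) hρ hinj
    (a := max 0 (t₀ - ε / 2)) (b := min 1 (t₀ + ε / 2)) (t := τ) (t' := τ')
    (fun τ hτ => (continuousWithinAt_matrix fun i j =>
      continuousWithinAt_connectionForm_velocity hs.isLocalFrameOn hs.isOpen hσ (hsub τ hτ).1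
        (hsub τ hτ).2 i j).neg.mono hJ01)
    (fun τ hτ => by
      obtain ⟨h, hh⟩ := hform _ _ hs (σ τ) (hsub τ hτ).2 (velocity σ τ)
      exact Submodule.neg_mem _ ⟨h, hh.symm⟩)
    (fun τ hτ => (hasDerivWithinAt_coeff_matrix hs.isLocalFrameOn hs.isOpen hξ (hsub τ hτ).1
      (hsub τ hτ).2).mono hJ01)
  have hstep : ∀ τ ∈ Icc (max 0 (t₀ - ε / 2)) (min 1 (t₀ + ε / 2)),
      ∀ τ' ∈ Icc (max 0 (t₀ - ε / 2)) (min 1 (t₀ + ε / 2)),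
      (𝒜.IsAdmissibleBasis (σ τ) fun j => ξ j τ) → 𝒜.IsAdmissibleBasis (σ τ') fun j => ξ j τ' := by
    intro τ hτ τ' hτ' h
    rw [hs.isAdmissibleBasis_iff (hsub τ hτ).2] at h
    rw [hs.isAdmissibleBasis_iff (hsub τ' hτ').2]
    obtain ⟨g, hg⟩ := h
    obtain ⟨g', hg'⟩ := hkey hτ hτ'
    exact ⟨g' * g, by rw [hg', hg, map_mul, Units.val_mul]⟩
  have hmem : t₀ ∈ Icc (max 0 (t₀ - ε / 2)) (min 1 (t₀ + ε / 2)) := by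
    rw [hJ]
    exact ⟨ht₀, Metric.mem_closedBall_self (half_pos hε).le⟩
  have hnhds : Icc (max 0 (t₀ - ε / 2)) (min 1 (t₀ + ε / 2)) ∈ 𝓝[Icc 0 1] t₀ := by
    rw [hJ]
    exact Filter.inter_mem self_mem_nhdsWithin
      (mem_nhdsWithin_of_mem_nhds (Metric.closedBall_mem_nhds _ (half_pos hε)))
  filter_upwards [hnhds] with τ hτ
  -- The implication is not symmetric in the two times, so the connectedness argument needs both
  -- directions.
  exact ⟨hstep _ hmem _ hτ, hstep _ hτ _ hmem⟩

/-- A connection whose connection forms take their values in the Lie algebra is admissible. -/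
lemma isAdmissibleConnection_of_connectionForm_mem (hρ : IsSmoothRep (EG := EG) ρ)
    (hinj : Function.Injective ρ)
    (hform : ∀ (U : Set M) (s : Fin k → (x : M) → V x) (hs : 𝒜.IsAdmissibleFrameOn s U),
        ∀ x ∈ U, ∀ v : TangentSpace 𝓘(ℝ, E) x,
          ∃ h : GroupLieAlgebra 𝓘(ℝ, EG) G,
            connectionForm cov hs.isLocalFrameOn x v = diffRep ρ h) :
    𝒜.IsAdmissibleConnection cov := by
  intro σ hσ b hb
  choose ξ hξ hξ0 hξ1 using fun j => parallelTransport_spec (cov := cov) hσ (b j)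
  simp only [hξ1]
  refine isAdmissibleBasis_of_isParallelAlong hρ hinj hform hσ hξ (t := 0) (by simp) (by simp) ?_
  simpa only [hξ0] using hb

/-- Parallel sections of an admissible connection which form an admissible basis at the beginning
of a curve in the domain of a local frame do so at all times. -/
lemma GBundleStructure.IsAdmissibleConnection.isAdmissibleBasis_of_isParallelAlong
    {G : Type*} [Group G] {ρ : G →* GL (Fin k) ℝ} {𝒜 : GBundleStructure E V ρ}
    (hadm : 𝒜.IsAdmissibleConnection cov) {s : Fin k → (x : M) → V x} {U : Set M}
    (hs : IsLocalFrameOn 𝓘(ℝ, E) (Fin k → ℝ) ∞ s U) (hU : IsOpen U) {σ : ℝ → M}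
    (hσ : ContMDiffOn 𝓘(ℝ, ℝ) 𝓘(ℝ, E) ∞ σ (Icc 0 1)) (hσU : ∀ t ∈ Icc (0 : ℝ) 1, σ t ∈ U)
    {ξ : Fin k → (t : ℝ) → V (σ t)} (hξ : ∀ j, IsParallelAlong cov σ (ξ j))
    (hξ0 : 𝒜.IsAdmissibleBasis (σ 0) fun j => ξ j 0) {τ : ℝ} (hτ : τ ∈ Icc (0 : ℝ) 1) :
    𝒜.IsAdmissibleBasis (σ τ) fun j => ξ j τ := by
  -- Writing the statement as a predicate of the time allows `τ * 0` and `τ * 1` to be rewritten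
  -- although the fibres depend on them.
  let Q : ℝ → Prop := fun r => 𝒜.IsAdmissibleBasis (σ r) fun j => ξ j r
  have hQ0 : Q (τ * 0) := by
    rw [mul_zero]
    exact hξ0
  have hστ := contMDiffOn_comp_mul hσ hτ
  have h1 := hadm _ hστ _ hQ0
  have h2 : ∀ j, parallelTransport cov (fun t => σ (τ * t)) (ξ j (τ * 0)) = ξ j (τ * 1) := by
    intro j
    obtain ⟨η, hη, hη0, hη1⟩ := parallelTransport_spec (cov := cov) hστ (ξ j (τ * 0))
    rw [hη1]
    -- Uniqueness identifies the section chosen by `parallelTransport` with the rescaling of `ξ j`.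
    exact hη.eq_of_eq_zero hs hU hστ (fun t ht => hσU _ (mul_mem_Icc_zero_one hτ ht))
      ((hξ j).comp_mul hσ hτ) hη0 (by simp)
  have h3 : Q (τ * 1) := by
    simp only [h2] at h1
    exact h1
  rw [mul_one] at h3
  exact h3

/-- The connection forms of an admissible connection in admissible frames take their values in the
Lie algebra. -/
lemma GBundleStructure.IsAdmissibleConnection.connectionForm_mem_range
    [T2Space G] [SecondCountableTopology G]
    (hρ : IsSmoothRep (EG := EG) ρ) (hinj : Function.Injective ρ)
    (hadm : 𝒜.IsAdmissibleConnection cov) {s : Fin k → (x : M) → V x} {U : Set M}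
    (hs : 𝒜.IsAdmissibleFrameOn s U) {x : M} (hx : x ∈ U) (v : TangentSpace 𝓘(ℝ, E) x) :
    connectionForm cov hs.isLocalFrameOn x v ∈ LinearMap.range (diffRep (EG := EG) ρ) := by
  obtain ⟨σ, hσ, hσU, c, hc, hvel⟩ := exists_curve_velocity hs.isOpen hx v
  choose ξ hξ hξ0 using fun j => exists_isParallelAlong (cov := cov) hσ (s j (σ 0))
  have h01 : (0 : ℝ) ∈ Icc (0 : ℝ) 1 := by simp
  have hadm0 : 𝒜.IsAdmissibleBasis (σ 0) fun j => ξ j 0 := by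
    simp only [hξ0]
    exact hs.isAdmissibleBasis _ (hσU 0 h01)
  have hA : ∀ t ∈ Icc (0 : ℝ) 1, HasDerivWithinAt _ _ (Icc 0 1) t := fun t ht =>
    hasDerivWithinAt_coeff_matrix hs.isLocalFrameOn hs.isOpen hξ ht (hσU t ht)
  have hA0 : (Matrix.of fun i j => hs.isLocalFrameOn.coeff i (σ 0) (ξ j 0)) = 1 := by
    ext i j
    rw [Matrix.of_apply, hξ0, hs.isLocalFrameOn.coeff_frame (hσU 0 h01), Matrix.one_apply]
  have hmem : -connectionForm cov hs.isLocalFrameOn (σ 0) (velocity σ 0) ∈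
      LinearMap.range (diffRep (EG := EG) ρ) := by
    -- The coefficient matrix starts at `1`, stays in `ρ(G)`, and its derivative `-ω(σ') A` tends to
    -- `-ω(σ'(0))`.
    refine mem_range_diffRep_of_curve hρ hinj zero_lt_one
      (A := fun t => Matrix.of fun i j => hs.isLocalFrameOn.coeff i (σ t) (ξ j t))
      (A' := fun t => -connectionForm cov hs.isLocalFrameOn (σ t) (velocity σ t) *
        Matrix.of fun i j => hs.isLocalFrameOn.coeff i (σ t) (ξ j t))
      (fun t ht => (hA t ht).continuousWithinAt)
      (fun t ht => (hA t (Ioo_subset_Icc_self ht)).hasDerivAt (Icc_mem_nhds ht.1 ht.2))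
      ?_ hA0 (fun t ht => (hs.isAdmissibleBasis_iff (hσU t ht)).mp
        (hadm.isAdmissibleBasis_of_isParallelAlong hs.isLocalFrameOn hs.isOpen hσ hσU hξ hadm0 ht))
    have h1 : ContinuousWithinAt (fun t => -connectionForm cov hs.isLocalFrameOn (σ t)
        (velocity σ t) * Matrix.of fun i j => hs.isLocalFrameOn.coeff i (σ t) (ξ j t))
        (Icc 0 1) 0 :=
      (continuousWithinAt_matrix fun i j => continuousWithinAt_connectionForm_velocity
        hs.isLocalFrameOn hs.isOpen hσ h01 (hσU 0 h01) i j).neg.mul (hA 0 h01).continuousWithinAt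
    have h2 := h1.tendsto
    rw [hA0, mul_one] at h2
    refine h2.mono_left ?_
    rw [← nhdsWithin_Ioo_eq_nhdsGT zero_lt_one]
    exact nhdsWithin_mono _ Ioo_subset_Icc_self
  have htransfer : ∀ p q : TangentBundle 𝓘(ℝ, E) M, p = q →
      connectionForm cov hs.isLocalFrameOn p.1 p.2 =
        connectionForm cov hs.isLocalFrameOn q.1 q.2 := by
    rintro p q rfl
    rfl
  have h3 := (Submodule.neg_mem_iff _).mp hmem
  rw [htransfer ⟨σ 0, velocity σ 0⟩ ⟨x, c • v⟩ hvel, connectionForm_smul] at h3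
  -- The sign and the speed `c ≠ 0` are harmless, since the range is a linear subspace.
  exact (Submodule.smul_mem_iff _ hc).mp h3

end AdmissibleConnections

/-! ### The structure equation and the curvature form -/

section Curvature

/-- The derivative of a map into a subspace of matrices lies in this subspace. -/
lemma mvfderiv_mem_submodule {E : Type*} [NormedAddCommGroup E] [NormedSpace ℝ E]
    {M : Type*} [TopologicalSpace M] [ChartedSpace E M] {k : ℕ}
    (W : Submodule ℝ (Matrix (Fin k) (Fin k) ℝ)) {F : Fin k → Fin k → M → ℝ} {x : M}
    (hF : ∀ i j, ContMDiffAt 𝓘(ℝ, E) 𝓘(ℝ, ℝ) ∞ (F i j) x)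
    (hW : ∀ᶠ y in 𝓝 x, (Matrix.of fun i j => F i j y) ∈ W) (v : TangentSpace 𝓘(ℝ, E) x) :
    (Matrix.of fun i j => mvfderiv 𝓘(ℝ, E) (F i j) x v) ∈ W := by
  have hΦ : MDifferentiableAt 𝓘(ℝ, E) 𝓘(ℝ, Fin k → Fin k → ℝ) (fun y i j => F i j y) x :=
    (contMDiffAt_pi_space.mpr fun i => contMDiffAt_pi_space.mpr fun j => hF i j).mdifferentiableAt
      (by simp)
  have hlin : ∀ L : (Fin k → Fin k → ℝ) →L[ℝ] ℝ,
      mvfderiv 𝓘(ℝ, E) (fun y => L fun i j => F i j y) x v =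
        L (mvfderiv 𝓘(ℝ, E) (fun y i j => F i j y) x v) := by
    intro L
    have h1 : HasMFDerivAt 𝓘(ℝ, E) 𝓘(ℝ, ℝ) (fun y => L fun i j => F i j y) x
        (L.comp (mvfderiv 𝓘(ℝ, E) (fun y i j => F i j y) x)) :=
      L.hasMFDerivAt.comp x hΦ.hasMFDerivAt
    exact congrArg (fun T : E →L[ℝ] ℝ => T v) h1.mfderiv
  have hD : (Matrix.of fun i j => mvfderiv 𝓘(ℝ, E) (F i j) x v) =
      mvfderiv 𝓘(ℝ, E) (fun y i j => F i j y) x v := by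
    ext i j
    exact hlin ((ContinuousLinearMap.proj j : (Fin k → ℝ) →L[ℝ] ℝ).comp
      (ContinuousLinearMap.proj i))
  rw [hD]
  by_contra hnot
  -- A linear form vanishing on `W` but not on the derivative would, composed with the map, be
  -- locally zero with nonzero derivative.
  obtain ⟨f, hf, hWf⟩ := W.exists_le_ker_of_notMem hnot
  let L : (Fin k → Fin k → ℝ) →L[ℝ] ℝ :=
    LinearMap.toContinuousLinearMap (f : (Fin k → Fin k → ℝ) →ₗ[ℝ] ℝ)
  have h1 : (fun y => L fun i j => F i j y) =ᶠ[𝓝 x] fun _ => 0 := by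
    filter_upwards [hW] with y hy using hWf hy
  have h2 : mvfderiv 𝓘(ℝ, E) (fun y => L fun i j => F i j y) x v = 0 := by
    have h3 := ((hasMFDerivAt_const (I := 𝓘(ℝ, E)) (I' := 𝓘(ℝ, ℝ)) (0 : ℝ)
      x).congr_of_eventuallyEq h1).mfderiv
    exact congrArg (fun T : E →L[ℝ] ℝ => T v) h3
  rw [hlin] at h2
  exact hf h2

variable {EG : Type*} [NormedAddCommGroup EG] [NormedSpace ℝ EG] [FiniteDimensional ℝ EG]
  {G : Type*} [TopologicalSpace G] [ChartedSpace EG G] [Group G] [LieGroup 𝓘(ℝ, EG) ∞ G]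
  {k : ℕ} {ρ : G →* GL (Fin k) ℝ}
  {E : Type*} [NormedAddCommGroup E] [NormedSpace ℝ E] [FiniteDimensional ℝ E]
  {M : Type*} [TopologicalSpace M] [ChartedSpace E M] [IsManifold 𝓘(ℝ, E) ∞ M] [T2Space M]
  {V : M → Type*} [TopologicalSpace (TotalSpace (Fin k → ℝ) V)]
  [∀ x, AddCommGroup (V x)] [∀ x, Module ℝ (V x)] [∀ x, TopologicalSpace (V x)]
  [∀ x, IsTopologicalAddGroup (V x)] [∀ x, ContinuousSMul ℝ (V x)]
  [FiberBundle (Fin k → ℝ) V] [VectorBundle ℝ (Fin k → ℝ) V]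
  [ContMDiffVectorBundle ∞ (Fin k → ℝ) V 𝓘(ℝ, E)]
  {𝒜 : GBundleStructure E V ρ}
  {cov : CovariantDerivative 𝓘(ℝ, E) (Fin k → ℝ) V}
  [CovariantDerivative.ContMDiffCovariantDerivative cov ∞]

omit [ContMDiffVectorBundle ∞ (Fin k → ℝ) V 𝓘(ℝ, E)] in
lemma contMDiffAt_cov_apply {t : (x : M) → V x} {U : Set M}
    (hU : IsOpen U) (ht : ContMDiffOn 𝓘(ℝ, E) (𝓘(ℝ, E).prod 𝓘(ℝ, Fin k → ℝ)) ∞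
      (fun y => (⟨y, t y⟩ : TotalSpace (Fin k → ℝ) V)) U)
    {X : (x : M) → TangentSpace 𝓘(ℝ, E) x} (hX : ContMDiffOn 𝓘(ℝ, E) 𝓘(ℝ, E).tangent ∞
      (fun x => (⟨x, X x⟩ : TangentBundle 𝓘(ℝ, E) M)) U) {x : M} (hx : x ∈ U) :
    ContMDiffAt 𝓘(ℝ, E) (𝓘(ℝ, E).prod 𝓘(ℝ, Fin k → ℝ)) ∞
      (fun y => (⟨y, cov t y (X y)⟩ : TotalSpace (Fin k → ℝ) V)) x :=
  ContMDiffAt.clm_bundle_apply (contMDiffAt_cov_of_contMDiffOn cov hU ht hx)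
    (hX.contMDiffAt (hU.mem_nhds hx))

omit [ContMDiffVectorBundle ∞ (Fin k → ℝ) V 𝓘(ℝ, E)] in
/-- The structure equation `Ω = dω + ω ∧ ω`. -/
lemma curvatureForm_eq {s : Fin k → (x : M) → V x} {U : Set M}
    (hs : IsLocalFrameOn 𝓘(ℝ, E) (Fin k → ℝ) ∞ s U) (hU : IsOpen U)
    {X Y : (x : M) → TangentSpace 𝓘(ℝ, E) x}
    (hX : ContMDiffOn 𝓘(ℝ, E) 𝓘(ℝ, E).tangent ∞
      (fun x => (⟨x, X x⟩ : TangentBundle 𝓘(ℝ, E) M)) U)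
    (hY : ContMDiffOn 𝓘(ℝ, E) 𝓘(ℝ, E).tangent ∞
      (fun x => (⟨x, Y x⟩ : TangentBundle 𝓘(ℝ, E) M)) U) {x : M} (hx : x ∈ U) :
    curvatureForm cov hs X Y x =
      (connectionForm cov hs x (X x) * connectionForm cov hs x (Y x) -
        connectionForm cov hs x (Y x) * connectionForm cov hs x (X x)) +
      (Matrix.of fun j i =>
        mvfderiv 𝓘(ℝ, E) (fun y => connectionForm cov hs y (Y y) j i) x (X x)) -
      (Matrix.of fun j i =>
        mvfderiv 𝓘(ℝ, E) (fun y => connectionForm cov hs y (X y) j i) x (Y x)) -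
      connectionForm cov hs x (VectorField.mlieBracket 𝓘(ℝ, E) X Y x) := by
  ext j i
  -- The coefficients of `∇_A s_i` form the `i`-th column of `ω(A)`; differentiating along `B` gives
  -- `ω(B) ω(A) + B(ω(A))`.
  have hcov : ∀ {A B : (x : M) → TangentSpace 𝓘(ℝ, E) x},
      ContMDiffOn 𝓘(ℝ, E) 𝓘(ℝ, E).tangent ∞
        (fun x => (⟨x, A x⟩ : TangentBundle 𝓘(ℝ, E) M)) U →
      hs.coeff j x (cov (fun y => cov (s i) y (A y)) x (B x)) =
        (connectionForm cov hs x (B x) * connectionForm cov hs x (A x)) j i +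
          mvfderiv 𝓘(ℝ, E) (fun y => connectionForm cov hs y (A y) j i) x (B x) := by
    intro A B hA
    rw [coeff_cov hs hU hx (contMDiffAt_cov_apply hU (hs.contMDiffOn i) hA hx), Matrix.mul_apply]
    rfl
  have h1 : curvatureForm cov hs X Y x j i =
      hs.coeff j x (cov (fun y => cov (s i) y (Y y)) x (X x)) -
        hs.coeff j x (cov (fun y => cov (s i) y (X y)) x (Y x)) -
        connectionForm cov hs x (VectorField.mlieBracket 𝓘(ℝ, E) X Y x) j i := by
    simp only [curvatureForm, curvatureOperator, connectionForm, Matrix.of_apply, map_sub]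
  rw [h1, hcov hY, hcov hX]
  simp only [Matrix.sub_apply, Matrix.add_apply, Matrix.of_apply]
  ring

/-- The derivatives of a connection form which takes its values in the Lie algebra do so. -/
lemma GBundleStructure.IsAdmissibleConnection.mvfderiv_connectionForm_mem_range
    [T2Space G] [SecondCountableTopology G]
    (hρ : IsSmoothRep (EG := EG) ρ) (hinj : Function.Injective ρ)
    (hadm : 𝒜.IsAdmissibleConnection cov) {s : Fin k → (x : M) → V x} {U : Set M}
    (hs : 𝒜.IsAdmissibleFrameOn s U) {X : (x : M) → TangentSpace 𝓘(ℝ, E) x}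
    (hX : ContMDiffOn 𝓘(ℝ, E) 𝓘(ℝ, E).tangent ∞
      (fun x => (⟨x, X x⟩ : TangentBundle 𝓘(ℝ, E) M)) U) {x : M} (hx : x ∈ U)
    (v : TangentSpace 𝓘(ℝ, E) x) :
    (Matrix.of fun j i => mvfderiv 𝓘(ℝ, E)
      (fun y => connectionForm cov hs.isLocalFrameOn y (X y) j i) x v) ∈
        LinearMap.range (diffRep (EG := EG) ρ) := by
  refine mvfderiv_mem_submodule _ (fun j i => ?_) ?_ v
  · exact hs.isLocalFrameOn.contMDiffAt_coeff hs.isOpen hx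
      (contMDiffAt_cov_apply hs.isOpen (hs.isLocalFrameOn.contMDiffOn i) hX hx) j
  · filter_upwards [hs.isOpen.mem_nhds hx] with y hy
    exact hadm.connectionForm_mem_range hρ hinj hs hy (X y)

/-- The curvature forms of an admissible connection in admissible frames take their values in the
Lie algebra. -/
lemma GBundleStructure.IsAdmissibleConnection.curvatureForm_mem_range
    [T2Space G] [SecondCountableTopology G]
    (hρ : IsSmoothRep (EG := EG) ρ) (hinj : Function.Injective ρ)
    (hadm : 𝒜.IsAdmissibleConnection cov) {s : Fin k → (x : M) → V x} {U : Set M}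
    (hs : 𝒜.IsAdmissibleFrameOn s U) {X Y : (x : M) → TangentSpace 𝓘(ℝ, E) x}
    (hX : ContMDiffOn 𝓘(ℝ, E) 𝓘(ℝ, E).tangent ∞
      (fun x => (⟨x, X x⟩ : TangentBundle 𝓘(ℝ, E) M)) U)
    (hY : ContMDiffOn 𝓘(ℝ, E) 𝓘(ℝ, E).tangent ∞
      (fun x => (⟨x, Y x⟩ : TangentBundle 𝓘(ℝ, E) M)) U) {x : M} (hx : x ∈ U) :
    curvatureForm cov hs.isLocalFrameOn X Y x ∈ LinearMap.range (diffRep (EG := EG) ρ) := by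
  have hform := hadm.connectionForm_mem_range (EG := EG) hρ hinj hs hx
  rw [curvatureForm_eq hs.isLocalFrameOn hs.isOpen hX hY hx]
  -- Each of the four terms of the structure equation lies in the Lie algebra separately.
  exact Submodule.sub_mem _ (Submodule.sub_mem _ (Submodule.add_mem _
    (commutator_mem_range_diffRep hρ hinj (hform _) (hform _))
    (hadm.mvfderiv_connectionForm_mem_range hρ hinj hs hY hx _))
    (hadm.mvfderiv_connectionForm_mem_range hρ hinj hs hX hx _)) (hform _)

end Curvature

end

theorem mainTheorem11
    {EG : Type*} [NormedAddCommGroup EG] [NormedSpace ℝ EG] [FiniteDimensional ℝ EG]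
    {G : Type*} [TopologicalSpace G] [ChartedSpace EG G] [Group G] [LieGroup 𝓘(ℝ, EG) ∞ G]
    [T2Space G] [SecondCountableTopology G]
    {k : ℕ} (ρ : G →* GL (Fin k) ℝ) (hρ : IsSmoothRep (EG := EG) ρ)
    (hρ_inj : Function.Injective ρ)
    {E : Type*} [NormedAddCommGroup E] [NormedSpace ℝ E] [FiniteDimensional ℝ E]
    {M : Type*} [TopologicalSpace M] [ChartedSpace E M] [IsManifold 𝓘(ℝ, E) ∞ M]
    [T2Space M] [SecondCountableTopology M]
    {V : M → Type*} [TopologicalSpace (TotalSpace (Fin k → ℝ) V)]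
    [∀ x, AddCommGroup (V x)] [∀ x, Module ℝ (V x)] [∀ x, TopologicalSpace (V x)]
    [∀ x, IsTopologicalAddGroup (V x)] [∀ x, ContinuousSMul ℝ (V x)]
    [FiberBundle (Fin k → ℝ) V] [VectorBundle ℝ (Fin k → ℝ) V]
    [ContMDiffVectorBundle ∞ (Fin k → ℝ) V 𝓘(ℝ, E)]
    (𝒜 : GBundleStructure E V ρ)
    (cov : CovariantDerivative 𝓘(ℝ, E) (Fin k → ℝ) V)
    [CovariantDerivative.ContMDiffCovariantDerivative cov ∞] :
    (𝒜.IsAdmissibleConnection cov ↔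
      ∀ (U : Set M) (s : Fin k → (x : M) → V x) (hs : 𝒜.IsAdmissibleFrameOn s U),
        ∀ x ∈ U, ∀ v : TangentSpace 𝓘(ℝ, E) x,
          ∃ h : GroupLieAlgebra 𝓘(ℝ, EG) G,
            connectionForm cov hs.isLocalFrameOn x v = diffRep ρ h) ∧
    (𝒜.IsAdmissibleConnection cov →
      ∀ (U : Set M) (s : Fin k → (x : M) → V x) (hs : 𝒜.IsAdmissibleFrameOn s U)
        (X Y : (x : M) → TangentSpace 𝓘(ℝ, E) x),
        ContMDiffOn 𝓘(ℝ, E) 𝓘(ℝ, E).tangent ∞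
          (fun x => (⟨x, X x⟩ : TangentBundle 𝓘(ℝ, E) M)) U →
        ContMDiffOn 𝓘(ℝ, E) 𝓘(ℝ, E).tangent ∞
          (fun x => (⟨x, Y x⟩ : TangentBundle 𝓘(ℝ, E) M)) U →
        ∀ x ∈ U, ∃ h : GroupLieAlgebra 𝓘(ℝ, EG) G,
          curvatureForm cov hs.isLocalFrameOn X Y x = diffRep ρ h) := by
  refine ⟨⟨fun hadm U s hs x hx v => ?_, isAdmissibleConnection_of_connectionForm_mem hρ hρ_inj⟩,
    fun hadm U s hs X Y hX hY x hx => ?_⟩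
  · obtain ⟨h, hh⟩ := hadm.connectionForm_mem_range hρ hρ_inj hs hx v
    exact ⟨h, hh.symm⟩
  · obtain ⟨h, hh⟩ := hadm.curvatureForm_mem_range hρ hρ_inj hs hX hY hx
    exact ⟨h, hh.symm⟩
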